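/- Let $\mathbf k$ be a field of characteristic $0$, let $V$ be a $\mathbf k$-vector space with basis $w_1,\dots,w_k$, $k\ge 3$, and let $\mathbf q=(q_{ij})$ with $q_{ij}\in\mathbf k^\times$, $q_{ii}=1$, $q_{ji}=q_{ij}^{-1}$. Let $S_{\mathbf q}(V)=T(V)/(w_iw_j-q_{ij}w_jw_i)$ and $\bigwedge_{\mathbf q^{-1}}(V^*)=T(V^*)/(w_i^*w_j^*+q_{ij}^{-1}w_j^*w_i^*)$, where $w_1^*,\dots,w_k^*$ is the dual basis. Let $G$ be a finite group acting on $S_{\mathbf q}(V)$ by algebra automorphisms with $g(w_i)=\chi_i(g)w_i$, $\chi_i(g)\in\mathbf k^\times$, and let $S_{\mathbf q}(V)\#G$ be the smash product, $(a\#g)(b\#h)=a\,g(b)\#gh$. Let $q,\lambda_1,\dots,\lambda_k\in\mathbf k^\times$, let $\xi:G\to\mathbf k^\times$ be a homomorphism, let $g_1,g_2\in G$, and let $P_1,P_2$ lie in the subalgebra of $S_{\mathbf q}(V)$ generated by $w_3,\dots,w_k$. Suppose there are scalars $q_{P_i,w_j}$ with $P_iw_j=q_{P_i,w_j}w_jP_i$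 for $i=1,2$ and all $j\ne i$. Let $\sigma,D_1,D_2:V\oplus\mathbf kG\to S_{\mathbf q}(V)\#G$ be the linear maps with $\sigma(w_i)=\lambda_iw_i$, $\sigma(g)=\xi(g)g$, $D_1(w_1)=P_1g_1$, $D_2(w_2)=P_2g_2$, $D_1(w_i)=0$ for $i\neq1$, $D_2(w_i)=0$ for $i\ne2$, and $D_1(g)=D_2(g)=0$ for $g\in G$. Denote by the same letters their linear extensions to $S_{\mathbf q}(V)\#G$ determined by $\sigma(xy)=\sigma(x)\sigma(y)$, $D_1(xy)=D_1(x)\sigma(y)+xD_1(y)$ and $D_2(xy)=D_2(x)y+\sigma(x)D_2(y)$. Assume: 1. $q_{P_1,w_i}=q_{1i}\lambda_i^{-1}\chi_i(g_1^{-1})$ for $i\neq1$, and $q_{P_2,w_i}=q_{2i}\lambda_i\chi_i(g_2^{-1})$ for $i\ne2$; 2. $g_1,g_2$ lie in the center of $G$; 3. $g(P_1)=\chi_1(g)\xi(g)P_1$ and $g(P_2)=\chi_2(g)\xi(g^{-1})P_2$ for all $g\in G$; 4. $D_2(P_1)=0$ and $D_1(P_2)=0$; 5. $\sigma(P_i)=q^{-1}\lambda_i\,\xi(g_i^{-1})P_i$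 for $i=1,2$; 6. if $q$ is a primitive $n$-th root of unity with $n\ge2$, then $D_1^n=D_2^n=0$. Put $\kappa=P_1g_1P_2g_2\otimes w_1^*\wedge w_2^*\in S_{\mathbf q}(V)\#G\otimes\bigwedge_{\mathbf q^{-1}}(V^*)$. Then: (a) $\kappa$ lies in the span of the elements $(w^\alpha\#g)\otimes(w^*)^{\wedge\beta}$ with $g\in G$, $\beta\in\{0,1\}^k$, $|\beta|=2$, $\alpha\in\mathbb N^k$ and $\alpha-\beta\in C_g$, where $C_g$ is the set of all $\gamma\in(\mathbb N\cup\{-1\})^k$ such that for every $i$ either $\prod_jq_{ij}^{\gamma_j}=\chi_i(g)$ or $\gamma_i=-1$ (Naidu's description of $\mathrm{HH}^2(S_{\mathbf q}(V),S_{\mathbf q}(V)\#G)$); and $\kappa$ represents exactly one class of $\mathrm{HH}^2(S_{\mathbf q}(V),S_{\mathbf q}(V)\#G)$. (b) $\kappa$ is $G$-invariant, where $g(a\#h)=g(a)\#ghg^{-1}$ and $g(w_i^*)=\chi_i(g)^{-1}w_i^*$. (c) $\kappa$ represents a class in $\mathrm{HH}^2(S_{\mathbf q}(V)\#G)$: there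 is exactly one class in $\mathrm{HH}^2(S_{\mathbf q}(V)\#G)$ whose restriction to $\mathrm{HH}^2(S_{\mathbf q}(V),S_{\mathbf q}(V)\#G)$ is represented by $\kappa$. Here $\kappa$ represents a class of $\mathrm{HH}^2(S_{\mathbf q}(V),S_{\mathbf q}(V)\#G)$ if the class contains a Hochschild $2$-cocycle $\gamma$ with $\sum_{i<j}\big(\gamma(w_i,w_j)-q_{ij}\gamma(w_j,w_i)\big)\otimes w_i^*\wedge w_j^*=\kappa$, that is, $\kappa$ is the pullback of $\gamma$ to the quantum Koszul resolution. -/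

import Mathlib

set_option maxSynthPendingDepth 3

open scoped TensorProduct

noncomputable section

/-! ### Quadratic quotients of the tensor algebra -/

section QAlg

variable {𝕜 V : Type*} [Field 𝕜] [AddCommGroup V] [Module 𝕜 V] {k : ℕ}

/-- The relations `w i * w j = c i j * w j * w i` in the tensor algebra `T(V)`. -/
inductive QAlg.Rel (w : Module.Basis (Fin k) 𝕜 V) (c : Fin k → Fin k → 𝕜) :
    TensorAlgebra 𝕜 V → TensorAlgebra 𝕜 V → Prop
  | comm (i j : Fin k) : QAlg.Rel w c
      (TensorAlgebra.ι 𝕜 (w i) * TensorAlgebra.ι 𝕜 (w j))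
      (c i j • (TensorAlgebra.ι 𝕜 (w j) * TensorAlgebra.ι 𝕜 (w i)))

/-- `T(V)` modulo the two-sided ideal generated by all `w i * w j - c i j * w j * w i`. -/
def QAlg (w : Module.Basis (Fin k) 𝕜 V) (c : Fin k → Fin k → 𝕜) : Type _ :=
  RingQuot (QAlg.Rel w c)

namespace QAlg

variable (w : Module.Basis (Fin k) 𝕜 V) (c : Fin k → Fin k → 𝕜)

instance : Ring (QAlg w c) := inferInstanceAs (Ring (RingQuot (QAlg.Rel w c)))

instance : Algebra 𝕜 (QAlg w c) := inferInstanceAs (Algebra 𝕜 (RingQuot (QAlg.Rel w c)))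

/-- The quotient map from the tensor algebra. -/
def mk : TensorAlgebra 𝕜 V →ₐ[𝕜] QAlg w c := RingQuot.mkAlgHom 𝕜 (QAlg.Rel w c)

/-- The image of the basis vector `w i`. -/
def gen (i : Fin k) : QAlg w c := mk w c (TensorAlgebra.ι 𝕜 (w i))

/-- The ordered monomial `w_1 ^ α_1 * ⋯ * w_k ^ α_k`. -/
def mono (α : Fin k → ℕ) : QAlg w c := (List.ofFn fun i => gen w c i ^ α i).prod

variable {w c}

theorem gen_mul_gen (i j : Fin k) :
    gen w c i * gen w c j = c i j • (gen w c j * gen w c i) := by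
  have h : mk w c _ = mk w c _ := RingQuot.mkAlgHom_rel 𝕜 (Rel.comm (w := w) (c := c) i j)
  simpa [gen] using h

/-- The universal property of the presentation. -/
def lift {B : Type*} [Ring B] [Algebra 𝕜 B] (x : Fin k → B)
    (hx : ∀ i j, x i * x j = c i j • (x j * x i)) : QAlg w c →ₐ[𝕜] B :=
  RingQuot.liftAlgHom 𝕜 ⟨TensorAlgebra.lift 𝕜 (w.constr 𝕜 x), by
    rintro _ _ ⟨i, j⟩
    simpa using hx i j⟩

@[simp]
theorem lift_gen {B : Type*} [Ring B] [Algebra 𝕜 B] (x : Fin k → B)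
    (hx : ∀ i j, x i * x j = c i j • (x j * x i)) (i : Fin k) :
    lift (w := w) x hx (gen w c i) = x i := by
  have h := RingQuot.liftAlgHom_mkAlgHom_apply 𝕜
    (TensorAlgebra.lift 𝕜 (w.constr 𝕜 x)) (s := Rel w c)
    (by rintro _ _ ⟨i, j⟩; simpa using hx i j) (TensorAlgebra.ι 𝕜 (w i))
  exact h.trans (by simp)

theorem algHom_ext {B : Type*} [Ring B] [Algebra 𝕜 B] {f g : QAlg w c →ₐ[𝕜] B}
    (h : ∀ i, f (gen w c i) = g (gen w c i)) : f = g := by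
  apply RingQuot.ringQuot_ext'
  apply TensorAlgebra.hom_ext
  exact w.ext h

variable (w c)

/-- The diagonal algebra endomorphism `w i ↦ t i * w i`. -/
def diag (t : Fin k → 𝕜ˣ) : QAlg w c →ₐ[𝕜] QAlg w c :=
  lift (fun i => (t i : 𝕜) • gen w c i) fun i j => by
    simp only [smul_mul_smul_comm]
    rw [gen_mul_gen i j, smul_smul, smul_smul]
    congr 1
    ring

@[simp]
theorem diag_gen (t : Fin k → 𝕜ˣ) (i : Fin k) :
    diag w c t (gen w c i) = (t i : 𝕜) • gen w c i := lift_gen _ _ _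

end QAlg

end QAlg

/-! ### The quantum symmetric algebra with a diagonal group action, and the smash product -/

section Smash

variable {𝕜 V : Type*} [Field 𝕜] [AddCommGroup V] [Module 𝕜 V] {k : ℕ} {G : Type*} [Group G]

/-- The quantum symmetric algebra `S_q(V) = T(V) / (w i * w j - q i j * w j * w i)`. The parameter
`χ` only records the action of `G` by algebra automorphisms with `g (w i) = χ i g * w i`. -/
def QSym (w : Module.Basis (Fin k) 𝕜 V) (Q : Fin k → Fin k → 𝕜ˣ) (_χ : Fin k → G →* 𝕜ˣ) :
    Type _ :=
  QAlg w fun i j => (Q i j : 𝕜)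

/-- The quantum exterior algebra `⋀_q(V) = T(V) / (w i * w j + q i j * w j * w i)`. -/
abbrev QExt (w : Module.Basis (Fin k) 𝕜 V) (Q : Fin k → Fin k → 𝕜ˣ) : Type _ :=
  QAlg w fun i j => -(Q i j : 𝕜)

variable (w : Module.Basis (Fin k) 𝕜 V) (Q : Fin k → Fin k → 𝕜ˣ) (χ : Fin k → G →* 𝕜ˣ)

namespace QSym

instance : Ring (QSym w Q χ) := inferInstanceAs (Ring (QAlg w fun i j => (Q i j : 𝕜)))

instance : Algebra 𝕜 (QSym w Q χ) :=
  inferInstanceAs (Algebra 𝕜 (QAlg w fun i j => (Q i j : 𝕜)))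

/-- The generator `w i` of `S_q(V)`. -/
def gen (i : Fin k) : QSym w Q χ := QAlg.gen w (fun i j => (Q i j : 𝕜)) i

/-- The monomial `w ^ α` of `S_q(V)`. -/
def mono (α : Fin k → ℕ) : QSym w Q χ := QAlg.mono w (fun i j => (Q i j : 𝕜)) α

/-- The automorphism of `S_q(V)` given by `g`, that is, `w i ↦ χ i g * w i`. -/
def act (g : G) : QSym w Q χ →ₐ[𝕜] QSym w Q χ :=
  QAlg.diag w (fun i j => (Q i j : 𝕜)) fun i => χ i g

variable {w Q χ} in
theorem algHom_ext {B : Type*} [Ring B] [Algebra 𝕜 B] {f g : QSym w Q χ →ₐ[𝕜] B}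
    (h : ∀ i, f (gen w Q χ i) = g (gen w Q χ i)) : f = g :=
  QAlg.algHom_ext h

@[simp]
theorem act_gen (g : G) (i : Fin k) :
    act w Q χ g (gen w Q χ i) = (χ i g : 𝕜) • gen w Q χ i :=
  QAlg.diag_gen _ _ _ _

theorem act_one : act w Q χ 1 = AlgHom.id 𝕜 _ := algHom_ext fun i => by simp

theorem act_mul (g h : G) : act w Q χ (g * h) = (act w Q χ g).comp (act w Q χ h) :=
  algHom_ext fun i => by simp [smul_smul, mul_comm]

instance : MulSemiringAction G (QSym w Q χ) where
  smul g a := act w Q χ g a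
  one_smul a := congrArg (fun f => f a) (act_one w Q χ)
  mul_smul g h a := congrArg (fun f => f a) (act_mul w Q χ g h)
  smul_zero g := map_zero (act w Q χ g)
  smul_add g := map_add (act w Q χ g)
  smul_one g := map_one (act w Q χ g)
  smul_mul g := map_mul (act w Q χ g)

theorem smul_gen (g : G) (i : Fin k) : g • gen w Q χ i = (χ i g : 𝕜) • gen w Q χ i :=
  act_gen w Q χ g i

instance : SMulCommClass G 𝕜 (QSym w Q χ) where
  smul_comm g r a := map_smul (act w Q χ g) r a

end QSym

/-- The smash product `S_q(V) # G`; `SkewMonoidAlgebra.single g a` is the element `a # g`, and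
`(a # g) * (b # h) = a * g(b) # g * h`. -/
abbrev Smash : Type _ := SkewMonoidAlgebra (QSym w Q χ) G

namespace Smash

/-- The inclusion `S_q(V) → S_q(V) # G`, `a ↦ a # 1`. -/
def incl : QSym w Q χ →ₐ[𝕜] Smash w Q χ where
  __ := SkewMonoidAlgebra.singleOneRingHom
  commutes' _ := rfl

/-- The element `1 # g` of `S_q(V) # G`. -/
def ofG (g : G) : Smash w Q χ := SkewMonoidAlgebra.single g 1

/-- The action of `G` on `S_q(V) # G`, `g(a # h) = g(a) # g * h * g⁻¹`, that is, conjugation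
by `1 # g`. -/
def conj (g : G) : Smash w Q χ →ₗ[𝕜] Smash w Q χ :=
  LinearMap.mulLeftRight 𝕜 (ofG w Q χ g, ofG w Q χ g⁻¹)

theorem conj_single (g h : G) (a : QSym w Q χ) :
    conj w Q χ g (SkewMonoidAlgebra.single h a) =
      SkewMonoidAlgebra.single (g * h * g⁻¹) (g • a) := by
  simp [conj, ofG, SkewMonoidAlgebra.single_mul_single]

end Smash

/-! ### Cochains `S_q(V) # G ⊗ ⋀_{q⁻¹}(V*)` -/

/-- The algebra `⋀_{q⁻¹}(V*)`, built on the basis of `V*` dual to `w`. -/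
abbrev DualExt : Type _ := QExt w.dualBasis Q⁻¹

/-- The dual basis vector `w i *` in `⋀_{q⁻¹}(V*)`. -/
def dualGen (i : Fin k) : DualExt w Q := QAlg.gen w.dualBasis _ i

/-- The element `(w*) ^ {∧ β}` of `⋀_{q⁻¹}(V*)`. -/
def dualMono (β : Fin k → ℕ) : DualExt w Q := QAlg.mono w.dualBasis _ β

/-- The action of `g` on `⋀_{q⁻¹}(V*)` with `g (w i *) = (χ i g)⁻¹ * w i *`. -/
def dualAct (g : G) : DualExt w Q →ₐ[𝕜] DualExt w Q :=
  QAlg.diag w.dualBasis _ fun i => (χ i g)⁻¹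

/-- The vector space `S_q(V) # G ⊗ ⋀_{q⁻¹}(V*)`. -/
abbrev Cochain : Type _ := Smash w Q χ ⊗[𝕜] DualExt w Q

/-- The diagonal action of `g` on `S_q(V) # G ⊗ ⋀_{q⁻¹}(V*)`. -/
def cochainAct (g : G) : Cochain w Q χ →ₗ[𝕜] Cochain w Q χ :=
  TensorProduct.map (Smash.conj w Q χ g) (dualAct w Q χ g).toLinearMap

/-- The set `C_g` of all `γ ∈ (ℕ ∪ {-1})^k` such that for every `i`, either
`∏ j, q i j ^ γ j = χ i g` or `γ i = -1`. -/
def naiduC (g : G) : Set (Fin k → ℤ) :=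
  {γ | (∀ i, -1 ≤ γ i) ∧ ∀ i, ∏ j, Q i j ^ γ j = χ i g ∨ γ i = -1}

/-- The subspace of `S_q(V) # G ⊗ ⋀_{q⁻¹}(V*)` spanned by the elements `(w^α # g) ⊗ (w*)^{∧ β}`
with `g ∈ G`, `β ∈ {0,1}^k`, `|β| = 2`, `α ∈ ℕ^k` and `α - β ∈ C_g`. -/
def naiduHH2 : Submodule 𝕜 (Cochain w Q χ) :=
  Submodule.span 𝕜 {x | ∃ (g : G) (β α : Fin k → ℕ), (∀ i, β i ≤ 1) ∧ ∑ i, β i = 2 ∧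
    (fun i => (α i : ℤ) - (β i : ℤ)) ∈ naiduC Q χ g ∧
    x = SkewMonoidAlgebra.single g (QSym.mono w Q χ α) ⊗ₜ[𝕜] dualMono w Q β}

end Smash

/-! ### Second Hochschild cohomology -/

section Hochschild

variable {𝕜 A B : Type*} [Field 𝕜] [Ring A] [Algebra 𝕜 A] [Ring B] [Algebra 𝕜 B]

/-- Hochschild 2-cocycles of `A` with values in `B`, an `A`-bimodule through `f : A → B`. -/
def hochCocycles2 (f : A →ₐ[𝕜] B) : Submodule 𝕜 (A →ₗ[𝕜] A →ₗ[𝕜] B) where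
  carrier := {γ | ∀ a b c, f a * γ b c - γ (a * b) c + γ a (b * c) - γ a b * f c = 0}
  zero_mem' := by intro a b c; simp
  add_mem' := by
    intro γ δ hγ hδ a b c
    have h := congrArg₂ (· + ·) (hγ a b c) (hδ a b c)
    simp only [LinearMap.add_apply, mul_add, add_mul, add_zero] at h ⊢
    rw [← h]; abel
  smul_mem' := by
    intro r γ hγ a b c
    have h := congrArg (r • ·) (hγ a b c)
    simpa [smul_sub, smul_add] using h

/-- The Hochschild differential on 1-cochains,
`(δ h)(a, b) = a h(b) - h(a b) + h(a) b`. -/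
def hochD1 (f : A →ₐ[𝕜] B) : (A →ₗ[𝕜] B) →ₗ[𝕜] A →ₗ[𝕜] A →ₗ[𝕜] B :=
  LinearMap.mk₂ 𝕜 (fun h a => LinearMap.mulLeft 𝕜 (f a) ∘ₗ h - h ∘ₗ LinearMap.mulLeft 𝕜 a
      + LinearMap.mulLeft 𝕜 (h a) ∘ₗ f.toLinearMap)
    (by intros; ext; simp [mul_add, add_mul]; abel)
    (by intros; ext; simp [smul_sub, smul_add])
    (by intros; ext; simp [add_mul]; abel)
    (by intros; ext; simp [smul_sub, smul_add])

theorem hochD1_apply (f : A →ₐ[𝕜] B) (h : A →ₗ[𝕜] B) (a b : A) :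
    hochD1 f h a b = f a * h b - h (a * b) + h a * f b := rfl

/-- Hochschild 2-coboundaries, as a subspace of the 2-cocycles. -/
def hochCoboundaries2 (f : A →ₐ[𝕜] B) : Submodule 𝕜 (hochCocycles2 f) :=
  (LinearMap.range (hochD1 f)).comap (hochCocycles2 f).subtype

/-- `HH²(A, B)`, where `B` is an `A`-bimodule through `f : A → B`. In particular `HH²(A)` is
`HH2 (AlgHom.id 𝕜 A)`. -/
abbrev HH2 (f : A →ₐ[𝕜] B) : Type _ := hochCocycles2 f ⧸ hochCoboundaries2 f

/-- Restriction of 2-cocycles along `f`. -/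
def hochRes2 (f : A →ₐ[𝕜] B) : hochCocycles2 (AlgHom.id 𝕜 B) →ₗ[𝕜] hochCocycles2 f where
  toFun γ := ⟨γ.1.compl₁₂ f.toLinearMap f.toLinearMap, fun a b c => by
    simpa using γ.2 (f a) (f b) (f c)⟩
  map_add' _ _ := rfl
  map_smul' _ _ := rfl

/-- The restriction map `HH²(B) → HH²(A, B)` along `f : A → B`. -/
def HH2.res (f : A →ₐ[𝕜] B) : HH2 (AlgHom.id 𝕜 B) →ₗ[𝕜] HH2 f :=
  Submodule.mapQ _ _ (hochRes2 f) <| by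
    rintro γ ⟨h, hh⟩
    refine ⟨h ∘ₗ f.toLinearMap, ?_⟩
    ext a b
    have := congrArg (fun δ => δ (f a) (f b)) hh
    simp only [hochD1_apply] at this
    change f a * h (f b) - h (f (a * b)) + h (f a) * f b = γ.1 (f a) (f b)
    rw [map_mul]
    exact this

end Hochschild

/-! ### Classes represented by elements of `S_q(V) # G ⊗ ⋀²_{q⁻¹}(V*)`, and skew derivations -/

section Main

variable {𝕜 V : Type*} [Field 𝕜] [AddCommGroup V] [Module 𝕜 V] {k : ℕ} {G : Type*} [Group G]
variable (w : Module.Basis (Fin k) 𝕜 V) (Q : Fin k → Fin k → 𝕜ˣ) (χ : Fin k → G →* 𝕜ˣ)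

/-- The pullback of a bar 2-cochain `γ` to the quantum Koszul resolution. The comparison map sends
the basis element `w i ∧ w j` (`i < j`) to `w i ⊗ w j - q i j * w j ⊗ w i`, and the Koszul cochain
`w i ∧ w j ↦ m i j` is written as the element `∑_{i<j} m i j ⊗ w i * ∧ w j *`. -/
def toKoszul (γ : QSym w Q χ →ₗ[𝕜] QSym w Q χ →ₗ[𝕜] Smash w Q χ) : Cochain w Q χ :=
  ∑ i, ∑ j ∈ Finset.Ioi i,
    (γ (QSym.gen w Q χ i) (QSym.gen w Q χ j)
      - (Q i j : 𝕜) • γ (QSym.gen w Q χ j) (QSym.gen w Q χ i)) ⊗ₜ[𝕜]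
        (dualGen w Q i * dualGen w Q j)

/-- The Koszul cochain `x` represents the class `c` of `HH²(S_q(V), S_q(V) # G)`: some bar cocycle
in the class `c` pulls back to `x` on the Koszul resolution. (Every Koszul coboundary is the
pullback of a bar coboundary, so no further coboundary is needed.) -/
def Represents (x : Cochain w Q χ) (c : HH2 (Smash.incl w Q χ)) : Prop :=
  ∃ γ : hochCocycles2 (Smash.incl w Q χ), Submodule.Quotient.mk γ = c ∧ toKoszul w Q χ γ.1 = x

/-- The linear maps `σ, D₁, D₂` on `S_q(V) # G` are the extensions of the maps on `V ⊕ 𝕜 G` with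
`σ (w i) = lam i * w i`, `σ g = ξ g * g`, `D₁ (w i₁) = P₁ g₁`, `D₂ (w i₂) = P₂ g₂`, and `D₁`, `D₂`
zero on all other `w i` and on `G`, obtained by imposing that `σ` is multiplicative, that
`D₁ (x y) = D₁ x * σ y + x * D₁ y` and that `D₂ (x y) = D₂ x * y + σ x * D₂ y`. -/
structure IsSkewExtension (i₁ i₂ : Fin k) (lam : Fin k → 𝕜ˣ) (ξ : G →* 𝕜ˣ)
    (P₁ P₂ : QSym w Q χ) (g₁ g₂ : G) (σ D₁ D₂ : Smash w Q χ →ₗ[𝕜] Smash w Q χ) : Prop where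
  sigma_gen : ∀ i, σ (Smash.incl w Q χ (QSym.gen w Q χ i)) =
    (lam i : 𝕜) • Smash.incl w Q χ (QSym.gen w Q χ i)
  sigma_ofG : ∀ g, σ (Smash.ofG w Q χ g) = (ξ g : 𝕜) • Smash.ofG w Q χ g
  sigma_mul : ∀ x y, σ (x * y) = σ x * σ y
  D₁_gen : D₁ (Smash.incl w Q χ (QSym.gen w Q χ i₁)) = SkewMonoidAlgebra.single g₁ P₁
  D₁_gen_ne : ∀ i, i ≠ i₁ → D₁ (Smash.incl w Q χ (QSym.gen w Q χ i)) = 0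
  D₁_ofG : ∀ g, D₁ (Smash.ofG w Q χ g) = 0
  D₁_mul : ∀ x y, D₁ (x * y) = D₁ x * σ y + x * D₁ y
  D₂_gen : D₂ (Smash.incl w Q χ (QSym.gen w Q χ i₂)) = SkewMonoidAlgebra.single g₂ P₂
  D₂_gen_ne : ∀ i, i ≠ i₂ → D₂ (Smash.incl w Q χ (QSym.gen w Q χ i)) = 0
  D₂_ofG : ∀ g, D₂ (Smash.ofG w Q χ g) = 0
  D₂_mul : ∀ x y, D₂ (x * y) = D₂ x * y + σ x * D₂ y

end Main

end

/-! The class is a cup product of two twisted derivations. Since `D₁` is an (id, σ)-derivation and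
`D₂` a (σ, id)-derivation, γ(a, b) = D₁(a) D₂(b) is a Hochschild 2-cocycle of the smash product. On
generators it is nonzero at most at (w₁, w₂), so its restriction pulls back to κ on the Koszul
resolution. This gives existence in (a) and (c).

Square-zero extensions supply both the derivations and the primitives. An algebra section of the
extension attached to a twisted cocycle writes that cocycle as a coboundary, and for the zero
cocycle it is a skew derivation. Sections come from presentations, so only relations among
generators need checking. For `D₁` and `D₂` these relations are conditions 1, 2 and 3
(`Smash.exists_skewDerivation_single`). For a cocycle of S_q(V) they say that its Koszul pullback
vanishes (`QSym.exists_primitive`), hence a Koszul cochain represents at most one class. Uniqueness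
in (c) then follows from injectivity of restriction, `HH2.res_incl_injective`, proved by averaging
over G, whose order is invertible in characteristic 0.

For Naidu's condition, P₁P₂ skew commutes with w₃, …, w_k. Linear independence of ordered monomials
forces each monomial of P₁P₂ to have the same commutation scalars
(`QSym.mem_span_mono_of_skewCommute`), which is the required character identity. At w₁ and w₂ the
exponent is −1. Invariance holds because the ξ-factors of P₁ and P₂ cancel and χ₁χ₂ cancels against
the action on w₁* ∧ w₂*. -/

noncomputable section

/-! ### Square-zero extensions by twisted cocycles -/

section TwistedExt

variable {𝕜 A B : Type*} [Field 𝕜] [Ring A] [Algebra 𝕜 A] [Ring B] [Algebra 𝕜 B]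

/-- `γ` is a Hochschild 2-cocycle of `A` with values in `B`, where `A` acts on `B` from the left
through `φ` and from the right through `ψ`. -/
def IsTwistedCocycle (φ ψ : A →ₐ[𝕜] B) (γ : A →ₗ[𝕜] A →ₗ[𝕜] B) : Prop :=
  ∀ a b c, φ a * γ b c - γ (a * b) c + γ a (b * c) - γ a b * ψ c = 0

/-- The square-zero extension of `A` by `B` defined by a twisted cocycle `γ`. -/
@[ext]
structure TwistedExt (φ ψ : A →ₐ[𝕜] B) {γ : A →ₗ[𝕜] A →ₗ[𝕜] B}
    (hγ : IsTwistedCocycle φ ψ γ) where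
  fst : A
  snd : B

namespace TwistedExt

variable {φ ψ : A →ₐ[𝕜] B} {γ : A →ₗ[𝕜] A →ₗ[𝕜] B} {hγ : IsTwistedCocycle φ ψ γ}

theorem cocycle_one_left (hγ : IsTwistedCocycle φ ψ γ) (a : A) : γ 1 a = γ 1 1 * ψ a := by
  have h := hγ 1 1 a
  simp only [map_one, one_mul, mul_one] at h
  rw [← sub_eq_zero, ← h]; abel

theorem cocycle_one_right (hγ : IsTwistedCocycle φ ψ γ) (a : A) : γ a 1 = φ a * γ 1 1 := by
  have h := hγ a 1 1
  simp only [map_one, mul_one] at h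
  rw [eq_comm, ← sub_eq_zero, ← h]; abel

/-- The underlying pair. -/
def toProd (x : TwistedExt φ ψ hγ) : A × B := (x.fst, x.snd)

theorem toProd_injective :
    Function.Injective (toProd : TwistedExt φ ψ hγ → A × B) := fun _ _ h =>
  TwistedExt.ext (congrArg Prod.fst h) (congrArg Prod.snd h)

instance : Zero (TwistedExt φ ψ hγ) := ⟨⟨0, 0⟩⟩
instance : Add (TwistedExt φ ψ hγ) := ⟨fun x y => ⟨x.fst + y.fst, x.snd + y.snd⟩⟩
instance : Neg (TwistedExt φ ψ hγ) := ⟨fun x => ⟨-x.fst, -x.snd⟩⟩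
instance : Sub (TwistedExt φ ψ hγ) := ⟨fun x y => ⟨x.fst - y.fst, x.snd - y.snd⟩⟩
instance {S : Type*} [SMul S A] [SMul S B] : SMul S (TwistedExt φ ψ hγ) :=
  ⟨fun r x => ⟨r • x.fst, r • x.snd⟩⟩
-- Cocycles are not assumed normalised, so the unit needs the correction −γ(1, 1).
instance : One (TwistedExt φ ψ hγ) := ⟨⟨1, -γ 1 1⟩⟩
instance : Mul (TwistedExt φ ψ hγ) :=
  ⟨fun x y => ⟨x.fst * y.fst, φ x.fst * y.snd + x.snd * ψ y.fst + γ x.fst y.fst⟩⟩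

instance : AddCommGroup (TwistedExt φ ψ hγ) :=
  toProd_injective.addCommGroup toProd rfl (fun _ _ => rfl) (fun _ => rfl) (fun _ _ => rfl)
    (fun _ _ => rfl) (fun _ _ => rfl)

@[simp] theorem zero_fst : (0 : TwistedExt φ ψ hγ).fst = 0 := rfl
@[simp] theorem zero_snd : (0 : TwistedExt φ ψ hγ).snd = 0 := rfl
@[simp] theorem one_fst : (1 : TwistedExt φ ψ hγ).fst = 1 := rfl
@[simp] theorem one_snd : (1 : TwistedExt φ ψ hγ).snd = -γ 1 1 := rfl
@[simp] theorem add_fst (x y : TwistedExt φ ψ hγ) : (x + y).fst = x.fst + y.fst := rfl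
@[simp] theorem add_snd (x y : TwistedExt φ ψ hγ) : (x + y).snd = x.snd + y.snd := rfl
@[simp] theorem mul_fst (x y : TwistedExt φ ψ hγ) : (x * y).fst = x.fst * y.fst := rfl
@[simp] theorem mul_snd (x y : TwistedExt φ ψ hγ) :
    (x * y).snd = φ x.fst * y.snd + x.snd * ψ y.fst + γ x.fst y.fst := rfl
@[simp] theorem smul_fst (r : 𝕜) (x : TwistedExt φ ψ hγ) : (r • x).fst = r • x.fst := rfl
@[simp] theorem smul_snd (r : 𝕜) (x : TwistedExt φ ψ hγ) : (r • x).snd = r • x.snd := rfl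

instance : Module 𝕜 (TwistedExt φ ψ hγ) :=
  toProd_injective.module 𝕜 ⟨⟨toProd, rfl⟩, fun _ _ => rfl⟩ fun _ _ => rfl

instance : Ring (TwistedExt φ ψ hγ) where
  __ := (inferInstance : AddCommGroup (TwistedExt φ ψ hγ))
  left_distrib x y z := by ext <;> simp [mul_add]; abel
  right_distrib x y z := by ext <;> simp [add_mul]; abel
  zero_mul x := by ext <;> simp
  mul_zero x := by ext <;> simp
  one_mul x := by ext <;> simp [cocycle_one_left hγ x.fst]
  mul_one x := by ext <;> simp [cocycle_one_right hγ x.fst]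
  -- Associativity in the second component is exactly the cocycle identity.
  mul_assoc x y z := by
    ext
    · simp [mul_assoc]
    · have h := hγ x.fst y.fst z.fst
      simp only [mul_snd, mul_fst, map_mul, mul_add, add_mul, mul_assoc]
      rw [eq_comm, ← sub_eq_zero, ← h]; abel

instance : Algebra 𝕜 (TwistedExt φ ψ hγ) :=
  Algebra.ofModule (fun r x y => by ext <;> simp [smul_add])
    (fun r x y => by ext <;> simp [smul_add])

variable (hγ) in
/-- The projection onto `A`. -/
def fstHom : TwistedExt φ ψ hγ →ₐ[𝕜] A :=
  AlgHom.ofLinearMap ⟨⟨fst, fun _ _ => rfl⟩, fun _ _ => rfl⟩ rfl fun _ _ => rfl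

@[simp] theorem fstHom_apply (x : TwistedExt φ ψ hγ) : fstHom hγ x = x.fst := rfl

variable (hγ) in
/-- The linear projection onto `B`. -/
def sndLin : TwistedExt φ ψ hγ →ₗ[𝕜] B := ⟨⟨snd, fun _ _ => rfl⟩, fun _ _ => rfl⟩

@[simp] theorem sndLin_apply (x : TwistedExt φ ψ hγ) : sndLin hγ x = x.snd := rfl

/-- An algebra section of the extension trivialises the cocycle. -/
theorem snd_section_mul {s : A →ₐ[𝕜] TwistedExt φ ψ hγ}
    (hs : (fstHom hγ).comp s = AlgHom.id 𝕜 A) (a b : A) :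
    (s (a * b)).snd = φ a * (s b).snd + (s a).snd * ψ b + γ a b := by
  have h : ∀ a, (s a).fst = a := fun a => congrArg (fun f => f a) hs
  rw [map_mul, mul_snd, h, h]

end TwistedExt

/-- Algebra sections of the extension for the zero cocycle are the (φ, ψ)-skew derivations. -/
theorem isTwistedCocycle_zero (φ ψ : A →ₐ[𝕜] B) : IsTwistedCocycle φ ψ 0 := by
  intro a b c; simp

end TwistedExt

/-! ### Universal properties, primitives and skew derivations -/

section Lift

variable {𝕜 V : Type*} [Field 𝕜] [AddCommGroup V] [Module 𝕜 V] {k : ℕ} {G : Type*} [Group G]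
variable {w : Module.Basis (Fin k) 𝕜 V} {Q : Fin k → Fin k → 𝕜ˣ} {χ : Fin k → G →* 𝕜ˣ}

namespace QSym

/-- The universal property of `S_q(V)`. -/
def lift {C : Type*} [Ring C] [Algebra 𝕜 C] (x : Fin k → C)
    (hx : ∀ i j, x i * x j = (Q i j : 𝕜) • (x j * x i)) : QSym w Q χ →ₐ[𝕜] C :=
  QAlg.lift x hx

@[simp]
theorem lift_gen {C : Type*} [Ring C] [Algebra 𝕜 C] (x : Fin k → C)
    (hx : ∀ i j, x i * x j = (Q i j : 𝕜) • (x j * x i)) (i : Fin k) :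
    lift (w := w) (χ := χ) x hx (gen w Q χ i) = x i :=
  QAlg.lift_gen x hx i

theorem gen_mul_gen (i j : Fin k) :
    gen w Q χ i * gen w Q χ j = (Q i j : 𝕜) • (gen w Q χ j * gen w Q χ i) :=
  QAlg.gen_mul_gen i j

/-- A Hochschild cocycle of `S_q(V)` which is compatible with the defining relations is a
coboundary. -/
theorem exists_primitive {B : Type*} [Ring B] [Algebra 𝕜 B] {φ ψ : QSym w Q χ →ₐ[𝕜] B}
    {γ : QSym w Q χ →ₗ[𝕜] QSym w Q χ →ₗ[𝕜] B} (hγ : IsTwistedCocycle φ ψ γ)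
    (h : ∀ i j, γ (gen w Q χ i) (gen w Q χ j) = (Q i j : 𝕜) • γ (gen w Q χ j) (gen w Q χ i)) :
    ∃ f : QSym w Q χ →ₗ[𝕜] B, ∀ a b, f (a * b) = φ a * f b + f a * ψ b + γ a b := by
  -- The product of (w i, 0) and (w j, 0) has second component γ(w i, w j), so `h` is the defining
  -- relation for these lifts.
  let s : QSym w Q χ →ₐ[𝕜] TwistedExt φ ψ hγ := lift (fun i => ⟨gen w Q χ i, 0⟩) fun i j => by
    ext
    · exact gen_mul_gen i j
    · simpa using h i j
  have hs : (TwistedExt.fstHom hγ).comp s = AlgHom.id 𝕜 _ := algHom_ext fun i => by simp [s]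
  exact ⟨TwistedExt.sndLin hγ ∘ₗ s.toLinearMap, TwistedExt.snd_section_mul hs⟩

end QSym

namespace Smash

@[simp]
theorem incl_apply (a : QSym w Q χ) : incl w Q χ a = SkewMonoidAlgebra.single 1 a := rfl

theorem ofG_one : ofG w Q χ 1 = 1 := rfl

theorem ofG_mul (g h : G) : ofG w Q χ (g * h) = ofG w Q χ g * ofG w Q χ h := by
  simp [ofG, SkewMonoidAlgebra.single_mul_single]

theorem single_eq (g : G) (a : QSym w Q χ) :
    SkewMonoidAlgebra.single g a = incl w Q χ a * ofG w Q χ g := by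
  simp [ofG, SkewMonoidAlgebra.single_mul_single]

theorem ofG_mul_incl (g : G) (a : QSym w Q χ) :
    ofG w Q χ g * incl w Q χ a = incl w Q χ (g • a) * ofG w Q χ g := by
  simp [ofG, SkewMonoidAlgebra.single_mul_single]

/-- The universal property of `S_q(V) # G`. -/
theorem exists_lift {C : Type*} [Ring C] [Algebra 𝕜 C] (x : Fin k → C) (u : G →* C)
    (hx : ∀ i j, x i * x j = (Q i j : 𝕜) • (x j * x i))
    (hu : ∀ g i, u g * x i = (χ i g : 𝕜) • (x i * u g)) :
    ∃ s : Smash w Q χ →ₐ[𝕜] C, (∀ i, s (incl w Q χ (QSym.gen w Q χ i)) = x i) ∧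
      ∀ g, s (ofG w Q χ g) = u g := by
  have hinv : ∀ g, u g * u g⁻¹ = 1 := fun g => by rw [← map_mul]; simp
  have hinv' : ∀ g, u g⁻¹ * u g = 1 := fun g => by rw [← map_mul]; simp
  let f : QSym w Q χ →ₐ[𝕜] C := QSym.lift x hx
  have key : ∀ (g : G) (a : QSym w Q χ), f (g • a) * u g = u g * f a := by
    intro g a
    -- Conjugation by `u g` is an algebra map, so covariance of `f` need only be checked on
    -- generators.
    let c : C →ₐ[𝕜] C := AlgHom.ofLinearMap (LinearMap.mulLeftRight 𝕜 (u g, u g⁻¹))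
      (by simp [hinv]) (fun y z => by
        simp only [LinearMap.mulLeftRight_apply, mul_assoc]
        rw [← mul_assoc (u g⁻¹) (u g), hinv', one_mul])
    have h : f.comp (QSym.act w Q χ g) = c.comp f := QSym.algHom_ext fun i => by
      simp [f, c, hu, mul_assoc, hinv]
    have h' : f (g • a) = u g * f a * u g⁻¹ := congrArg (fun f => f a) h
    rw [h', mul_assoc, hinv', mul_one]
  refine ⟨SkewMonoidAlgebra.liftNCAlgHom f u (fun {a g} => key g a), fun i => ?_, fun g => ?_⟩
  · change SkewMonoidAlgebra.liftNC (f : QSym w Q χ →+ C) u (SkewMonoidAlgebra.single 1 _) = x i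
    simp [f]
  · change SkewMonoidAlgebra.liftNC (f : QSym w Q χ →+ C) u (SkewMonoidAlgebra.single g _) = u g
    simp

theorem algHom_ext {C : Type*} [Ring C] [Algebra 𝕜 C] {s t : Smash w Q χ →ₐ[𝕜] C}
    (h₁ : ∀ i, s (incl w Q χ (QSym.gen w Q χ i)) = t (incl w Q χ (QSym.gen w Q χ i)))
    (h₂ : ∀ g, s (ofG w Q χ g) = t (ofG w Q χ g)) : s = t := by
  have h : s.comp (incl w Q χ) = t.comp (incl w Q χ) := QSym.algHom_ext h₁
  have hl : s.toLinearMap = t.toLinearMap := SkewMonoidAlgebra.lhom_ext fun g a => by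
    change s _ = t _
    rw [single_eq, map_mul, map_mul, h₂]
    exact congrArg (· * _) (congrArg (fun f => f a) h)
  exact AlgHom.toLinearMap_injective hl

/-- Existence of the skew derivation of `S_q(V) # G` with prescribed values on the generators
`w i` which vanishes on `G`. -/
theorem exists_skewDerivation (φ ψ : Smash w Q χ →ₐ[𝕜] Smash w Q χ) (y : Fin k → Smash w Q χ)
    (hy : ∀ i j, φ (incl w Q χ (QSym.gen w Q χ i)) * y j + y i * ψ (incl w Q χ (QSym.gen w Q χ j))
      = (Q i j : 𝕜) • (φ (incl w Q χ (QSym.gen w Q χ j)) * y i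
        + y j * ψ (incl w Q χ (QSym.gen w Q χ i))))
    (hu : ∀ g i, φ (ofG w Q χ g) * y i = (χ i g : 𝕜) • (y i * ψ (ofG w Q χ g))) :
    ∃ D : Smash w Q χ →ₗ[𝕜] Smash w Q χ, (∀ i, D (incl w Q χ (QSym.gen w Q χ i)) = y i) ∧
      (∀ g, D (ofG w Q χ g) = 0) ∧ ∀ a b, D (a * b) = φ a * D b + D a * ψ b := by
  have h0 := isTwistedCocycle_zero φ ψ
  -- The zero second component makes the resulting derivation vanish on G. The hypotheses `hy` and
  -- `hu` are the second components of the relations.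
  let u : G →* TwistedExt φ ψ h0 :=
    { toFun g := ⟨ofG w Q χ g, 0⟩
      map_one' := by ext1 <;> simp [ofG_one]
      map_mul' g h := by ext1 <;> simp [ofG_mul] }
  obtain ⟨s, hs₁, hs₂⟩ := exists_lift (w := w) (Q := Q) (χ := χ)
    (fun i => (⟨incl w Q χ (QSym.gen w Q χ i), y i⟩ : TwistedExt φ ψ h0)) u
    (fun i j => by
      ext1
      · simp only [TwistedExt.mul_fst, TwistedExt.smul_fst]
        rw [← map_mul, QSym.gen_mul_gen, map_smul, map_mul]
      · simpa using hy i j)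
    (fun g i => by
      ext1
      · change ofG w Q χ g * incl w Q χ _ = (χ i g : 𝕜) • (incl w Q χ _ * ofG w Q χ g)
        rw [ofG_mul_incl, QSym.smul_gen, map_smul, smul_mul_assoc]
      · simpa [u] using hu g i)
  have hs : (TwistedExt.fstHom h0).comp s = AlgHom.id 𝕜 _ :=
    algHom_ext (fun i => by
      change (s _).fst = _
      rw [hs₁]; rfl) (fun g => by
      change (s _).fst = _
      rw [hs₂]; rfl)
  refine ⟨TwistedExt.sndLin h0 ∘ₗ s.toLinearMap, fun i => ?_, fun g => ?_, fun a b => ?_⟩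
  · change (s _).snd = _
    rw [hs₁]
  · change (s _).snd = _
    rw [hs₂]; rfl
  · simpa using TwistedExt.snd_section_mul hs a b

end Smash

end Lift

/-! ### Koszul pullbacks determine classes -/

section Koszul

variable {𝕜 V : Type*} [Field 𝕜] [AddCommGroup V] [Module 𝕜 V] {k : ℕ} {G : Type*} [Group G]
variable {w : Module.Basis (Fin k) 𝕜 V} {Q : Fin k → Fin k → 𝕜ˣ} {χ : Fin k → G →* 𝕜ˣ}

/-- A linear functional on `⋀_{q⁻¹}(V*)` dual to `w i * ∧ w j *` among the exterior monomials of
degree two. -/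
theorem exists_functional_dualGen_mul
    (hQ_symm : ∀ i j, Q j i = (Q i j)⁻¹) {i j : Fin k} (hij : i < j) :
    ∃ ℓ : DualExt w Q →ₗ[𝕜] 𝕜, ∀ a b, a < b →
      ℓ (dualGen w Q a * dualGen w Q b) = if a = i ∧ b = j then 1 else 0 := by
  -- `X` and `Y` are left multiplication by x and y on the quantum exterior algebra with basis 1, x,
  -- y, xy and yx = −q_ij xy. All other generators act by zero, and the entry (3, 0) reads off the
  -- coefficient of xy.
  let X : Matrix (Fin 4) (Fin 4) 𝕜 := Matrix.single 1 0 1 + Matrix.single 3 2 1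
  let Y : Matrix (Fin 4) (Fin 4) 𝕜 :=
    Matrix.single 2 0 1 + Matrix.single 3 1 (-(Q i j : 𝕜))
  have hXX : X * X = 0 := by simp [X, add_mul, mul_add]
  have hYY : Y * Y = 0 := by simp [Y, add_mul, mul_add]
  have hXY : X * Y = Matrix.single 3 0 1 := by simp [X, Y, add_mul, mul_add]
  have hYX : Y * X = -(Q i j : 𝕜) • Matrix.single 3 0 1 := by
    simp only [X, Y, add_mul, mul_add, neg_smul, Matrix.smul_single]
    ext a b
    fin_cases a <;> fin_cases b <;> simp
  have hQ : ∀ a b, ((Q⁻¹ : Fin k → Fin k → 𝕜ˣ) a b : 𝕜) = (Q a b : 𝕜)⁻¹ := fun a b => by simp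
  have hne := (Q i j).ne_zero
  let x : Fin k → Matrix (Fin 4) (Fin 4) 𝕜 := fun a => if a = i then X else if a = j then Y else 0
  have hxi : x i = X := by simp [x]
  have hxj : x j = Y := by simp [x, hij.ne']
  have hx0 : ∀ a, a ≠ i → a ≠ j → x a = 0 := fun a h h' => by simp [x, h, h']
  let s : DualExt w Q →ₐ[𝕜] Matrix (Fin 4) (Fin 4) 𝕜 := QAlg.lift x fun a b => by
    rw [hQ]
    rcases eq_or_ne a i with rfl | ha
    · rcases eq_or_ne b a with rfl | hb
      · simp [hxi, hXX]
      · rcases eq_or_ne b j with rfl | hb'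
        · rw [hxi, hxj, hXY, hYX, smul_smul, neg_mul_neg, inv_mul_cancel₀ hne, one_smul]
        · simp [hx0 b hb hb']
    · rcases eq_or_ne a j with rfl | ha'
      · rcases eq_or_ne b i with rfl | hb
        · rw [hxi, hxj, hXY, hYX, hQ_symm b a]
          simp
        · rcases eq_or_ne b a with rfl | hb'
          · simp [hxj, hYY]
          · simp [hx0 b hb hb']
      · simp [hx0 a ha ha']
  have hs : ∀ a, s (dualGen w Q a) = x a := fun a => QAlg.lift_gen _ _ a
  refine ⟨Matrix.entryLinearMap 𝕜 𝕜 3 0 ∘ₗ s.toLinearMap, fun a b hab => ?_⟩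
  change (s (dualGen w Q a * dualGen w Q b)) 3 0 = _
  rw [map_mul, hs, hs]
  rcases eq_or_ne a i with rfl | ha
  · rcases eq_or_ne b j with rfl | hb
    · simp [hxi, hxj, hXY]
    · simp [hx0 b hab.ne' hb, hb]
  · rw [if_neg (fun h => ha h.1)]
    rcases eq_or_ne a j with rfl | ha'
    · rw [hx0 b (fun h => lt_asymm hij (h ▸ hab)) hab.ne', mul_zero]; rfl
    · rw [hx0 a ha ha', zero_mul]; rfl

/-- The components of the pullback of a cochain to the Koszul resolution are determined by the
pullback. -/
theorem toKoszul_eq_zero (hQ_diag : ∀ i, Q i i = 1)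
    (hQ_symm : ∀ i j, Q j i = (Q i j)⁻¹)
    {γ : QSym w Q χ →ₗ[𝕜] QSym w Q χ →ₗ[𝕜] Smash w Q χ} (h : toKoszul w Q χ γ = 0) (i j : Fin k) :
    γ (QSym.gen w Q χ i) (QSym.gen w Q χ j) =
      (Q i j : 𝕜) • γ (QSym.gen w Q χ j) (QSym.gen w Q χ i) := by
  have key : ∀ i j : Fin k, i < j → γ (QSym.gen w Q χ i) (QSym.gen w Q χ j) =
      (Q i j : 𝕜) • γ (QSym.gen w Q χ j) (QSym.gen w Q χ i) := by
    intro i j hij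
    obtain ⟨ℓ, hℓ⟩ := exists_functional_dualGen_mul (w := w) hQ_symm hij
    have h' := congrArg (TensorProduct.rid 𝕜 (Smash w Q χ) ∘
      TensorProduct.map (LinearMap.id : Smash w Q χ →ₗ[𝕜] Smash w Q χ) ℓ) h
    simp only [toKoszul, Function.comp_apply, map_sum, map_zero, TensorProduct.map_tmul,
      TensorProduct.rid_tmul, LinearMap.id_apply] at h'
    rw [Finset.sum_eq_single i, Finset.sum_eq_single j] at h'
    · rw [hℓ i j hij, if_pos ⟨rfl, rfl⟩, one_smul] at h'
      exact sub_eq_zero.mp h'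
    · intro b hb hbj
      rw [hℓ i b (Finset.mem_Ioi.mp hb), if_neg (fun h => hbj h.2), zero_smul]
    · intro hj
      exact absurd (Finset.mem_Ioi.mpr hij) hj
    · intro a _ hai
      refine Finset.sum_eq_zero fun b hb => ?_
      rw [hℓ a b (Finset.mem_Ioi.mp hb), if_neg (fun h => hai h.1), zero_smul]
    · simp
  rcases lt_trichotomy i j with hij | rfl | hij
  · exact key i j hij
  · simp [hQ_diag]
  · rw [key j i hij, smul_smul, hQ_symm j i]
    simp

theorem toKoszul_sub (γ δ : QSym w Q χ →ₗ[𝕜] QSym w Q χ →ₗ[𝕜] Smash w Q χ) :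
    toKoszul w Q χ (γ - δ) = toKoszul w Q χ γ - toKoszul w Q χ δ := by
  simp only [toKoszul, ← Finset.sum_sub_distrib, ← TensorProduct.sub_tmul, LinearMap.sub_apply,
    smul_sub]
  refine Finset.sum_congr rfl fun i _ => Finset.sum_congr rfl fun j _ => ?_
  congr 1
  abel

/-- A Koszul cochain represents at most one class. -/
theorem Represents.unique (hQ_diag : ∀ i, Q i i = 1) (hQ_symm : ∀ i j, Q j i = (Q i j)⁻¹)
    {x : Cochain w Q χ} {c c' : HH2 (Smash.incl w Q χ)} (h : Represents w Q χ x c)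
    (h' : Represents w Q χ x c') : c = c' := by
  obtain ⟨γ, rfl, hγ⟩ := h
  obtain ⟨γ', rfl, hγ'⟩ := h'
  rw [Submodule.Quotient.eq]
  have h0 : toKoszul w Q χ (γ - γ').1 = 0 := by
    change toKoszul w Q χ (γ.1 - γ'.1) = 0
    rw [toKoszul_sub, hγ, hγ', sub_self]
  obtain ⟨f, hf⟩ := QSym.exists_primitive (φ := Smash.incl w Q χ) (ψ := Smash.incl w Q χ)
    (γ - γ').2 (toKoszul_eq_zero hQ_diag hQ_symm h0)
  -- The primitive satisfies f(ab) = a f(b) + f(a) b + γ(a, b), so γ is the differential of −f.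
  refine ⟨-f, ?_⟩
  ext1 a
  ext1 b
  rw [hochD1_apply]
  simp only [LinearMap.neg_apply, hf, mul_neg, neg_mul]
  change _ = (γ - γ').1 a b
  abel

end Koszul

/-! ### Normalising cocycles along a finite group -/

section Normalize

variable {𝕜 B : Type*} [Field 𝕜] [CharZero 𝕜] [Ring B] [Algebra 𝕜 B] {G : Type*} [Group G]
  [Fintype G]

/-- A 2-cocycle of `B` is cohomologous to one which vanishes whenever the first argument lies in
the image of a given finite group. -/
theorem exists_left_normalization (u : G →* B) (γ : hochCocycles2 (AlgHom.id 𝕜 B)) :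
    ∃ h : B →ₗ[𝕜] B, ∀ t x, γ.1 (u t) x = hochD1 (AlgHom.id 𝕜 B) h (u t) x := by
  have hN : (Fintype.card G : 𝕜) ≠ 0 := Nat.cast_ne_zero.mpr Fintype.card_ne_zero
  let H : B →ₗ[𝕜] B := ∑ g, LinearMap.mulLeft 𝕜 (u g) ∘ₗ γ.1 (u g⁻¹)
  have hH : ∀ x, H x = ∑ g, u g * γ.1 (u g⁻¹) x := fun x => by simp [H]
  have key : ∀ t x, (Fintype.card G : 𝕜) • γ.1 (u t) x = hochD1 (AlgHom.id 𝕜 B) H (u t) x := by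
    intro t x
    have h1 : u t * H x = ∑ g, u g * γ.1 (u g⁻¹ * u t) x := by
      rw [hH, Finset.mul_sum]
      refine Fintype.sum_equiv (Equiv.mulLeft t) _ _ fun g => ?_
      simp [← mul_assoc, ← map_mul]
    rw [hochD1_apply, AlgHom.id_apply, AlgHom.id_apply, h1, hH, hH, Finset.sum_mul,
      ← Finset.sum_sub_distrib, ← Finset.sum_add_distrib, Nat.cast_smul_eq_nsmul,
      ← Finset.card_univ, ← Finset.sum_const]
    refine Finset.sum_congr rfl fun g _ => ?_
    -- Multiplied by u(g), the cocycle identity at (g⁻¹, t, x) isolates γ(t, x); summing over g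
    -- gives |G| copies of it.
    have h := congrArg (u g * ·) (γ.2 (u g⁻¹) (u t) x)
    simp only [AlgHom.id_apply, mul_sub, mul_add, ← mul_assoc, ← map_mul, mul_inv_cancel,
      map_one, one_mul, mul_zero] at h
    rw [← sub_eq_zero, ← h, map_mul u]
    abel
  refine ⟨(Fintype.card G : 𝕜)⁻¹ • H, fun t x => ?_⟩
  rw [map_smul, LinearMap.smul_apply, LinearMap.smul_apply, ← key, inv_smul_smul₀ hN]

/-- A 2-cocycle of `B` is cohomologous to one which vanishes whenever one of the arguments lies in
the image of a given finite group. -/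
theorem exists_normalization (u : G →* B) (γ : hochCocycles2 (AlgHom.id 𝕜 B)) :
    ∃ h : B →ₗ[𝕜] B, ∀ t x, γ.1 (u t) x = hochD1 (AlgHom.id 𝕜 B) h (u t) x ∧
      γ.1 x (u t) = hochD1 (AlgHom.id 𝕜 B) h x (u t) := by
  have hN : (Fintype.card G : 𝕜) ≠ 0 := Nat.cast_ne_zero.mpr Fintype.card_ne_zero
  obtain ⟨h, hh⟩ := exists_left_normalization u γ
  have hδ : hochD1 (AlgHom.id 𝕜 B) h ∈ hochCocycles2 (AlgHom.id 𝕜 B) := by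
    intro a b c
    simp only [hochD1_apply, AlgHom.id_apply, mul_sub, mul_add, sub_mul, add_mul, mul_assoc]
    abel
  obtain ⟨δ, hδγ⟩ : ∃ δ, δ = γ - ⟨_, hδ⟩ := ⟨_, rfl⟩
  have hδ' : ∀ x y, δ.1 x y = γ.1 x y - hochD1 (AlgHom.id 𝕜 B) h x y := fun x y => by
    rw [hδγ]; rfl
  have hleft : ∀ t x, δ.1 (u t) x = 0 := fun t x => by rw [hδ', hh, sub_self]
  -- The mirror average on the right. Since `δ` already vanishes on G from the left, `H` kills G and
  -- is left G-linear, so subtracting its differential preserves the left normalisation.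
  let H : B →ₗ[𝕜] B := ∑ g, LinearMap.mulRight 𝕜 (u g⁻¹) ∘ₗ δ.1.flip (u g)
  have hH : ∀ x, H x = ∑ g, δ.1 x (u g) * u g⁻¹ := fun x => by simp [H]
  have hHu : ∀ t, H (u t) = 0 := fun t => by simp [hH, hleft]
  have hHl : ∀ t x, H (u t * x) = u t * H x := by
    intro t x
    rw [hH, hH, Finset.mul_sum]
    refine Finset.sum_congr rfl fun g _ => ?_
    have h := δ.2 (u t) x (u g)
    simp only [AlgHom.id_apply, hleft, zero_mul, add_zero, sub_zero] at h
    rw [← sub_eq_zero.mp h, mul_assoc]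
  have hHr : ∀ x t, H x * u t - H (x * u t) = (Fintype.card G : 𝕜) • δ.1 x (u t) := by
    intro x t
    have h1 : H x * u t = ∑ g, δ.1 x (u t * u g) * u g⁻¹ := by
      rw [hH, Finset.sum_mul]
      symm
      refine Fintype.sum_equiv (Equiv.mulLeft t) _ _ fun g => ?_
      simp [mul_assoc, ← map_mul]
    rw [h1, hH, ← Finset.sum_sub_distrib, Nat.cast_smul_eq_nsmul, ← Finset.card_univ,
      ← Finset.sum_const]
    refine Finset.sum_congr rfl fun g _ => ?_
    have h := congrArg (· * u g⁻¹) (δ.2 x (u t) (u g))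
    simp only [AlgHom.id_apply, hleft, mul_zero, sub_mul, add_mul, zero_sub, neg_mul, zero_mul, mul_assoc,
      ← map_mul, mul_inv_cancel, map_one, mul_one] at h
    rw [← sub_eq_zero, ← h, map_mul u]
    abel
  refine ⟨h + (Fintype.card G : 𝕜)⁻¹ • H, fun t x => ?_⟩
  have e₁ : hochD1 (AlgHom.id 𝕜 B) H (u t) x = 0 := by
    rw [hochD1_apply, AlgHom.id_apply, AlgHom.id_apply, hHl, hHu, zero_mul, add_zero, sub_self]
  have e₂ : hochD1 (AlgHom.id 𝕜 B) H x (u t) = (Fintype.card G : 𝕜) • δ.1 x (u t) := by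
    rw [hochD1_apply, AlgHom.id_apply, AlgHom.id_apply, hHu, ← hHr, mul_zero]
    abel
  rw [map_add, map_smul]
  simp only [LinearMap.add_apply, LinearMap.smul_apply]
  rw [e₁, e₂, inv_smul_smul₀ hN, hδ', smul_zero, add_zero]
  exact ⟨hh t x, by abel⟩

end Normalize

/-! ### Injectivity of restriction to the quantum symmetric algebra -/

section Restriction

variable {𝕜 V : Type*} [Field 𝕜] [AddCommGroup V] [Module 𝕜 V] {k : ℕ} {G : Type*} [Group G]
variable {w : Module.Basis (Fin k) 𝕜 V} {Q : Fin k → Fin k → 𝕜ˣ} {χ : Fin k → G →* 𝕜ˣ}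

/-- The right `𝕜 G`-linear extension of a linear map on `S_q(V)` to `S_q(V) # G`. -/
def Smash.extendRight (f : QSym w Q χ →ₗ[𝕜] Smash w Q χ) : Smash w Q χ →ₗ[𝕜] Smash w Q χ where
  toFun x := x.sum fun g a => f a * Smash.ofG w Q χ g
  map_add' x y := SkewMonoidAlgebra.sum_add_index' (by simp) (by simp [add_mul])
  map_smul' r x := by
    rw [SkewMonoidAlgebra.sum_smul_index' (by simp), SkewMonoidAlgebra.smul_sum]
    simp

theorem Smash.extendRight_single (f : QSym w Q χ →ₗ[𝕜] Smash w Q χ) (g : G) (a : QSym w Q χ) :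
    Smash.extendRight f (SkewMonoidAlgebra.single g a) = f a * Smash.ofG w Q χ g := by
  change (SkewMonoidAlgebra.single g a).sum (fun g a => f a * Smash.ofG w Q χ g) = _
  rw [SkewMonoidAlgebra.sum_single_index (by rw [map_zero, zero_mul])]

/-- The restriction `HH²(S_q(V) # G) → HH²(S_q(V), S_q(V) # G)` is injective. -/
theorem HH2.res_incl_injective [CharZero 𝕜] [Finite G] :
    Function.Injective (HH2.res (Smash.incl w Q χ)) := by
  cases nonempty_fintype G
  have hN : (Fintype.card G : 𝕜) ≠ 0 := Nat.cast_ne_zero.mpr Fintype.card_ne_zero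
  rw [injective_iff_map_eq_zero]
  intro c hc
  obtain ⟨γ, rfl⟩ := Submodule.Quotient.mk_surjective _ c
  have hc' : hochRes2 (Smash.incl w Q χ) γ ∈ hochCoboundaries2 (Smash.incl w Q χ) :=
    (Submodule.Quotient.mk_eq_zero _).mp hc
  obtain ⟨f₀, hf₀⟩ := hc'
  rw [Submodule.Quotient.mk_eq_zero]
  let u : G →* Smash w Q χ := SkewMonoidAlgebra.of (QSym w Q χ) G
  have hu : ∀ g, Smash.ofG w Q χ g = u g := fun g => by simp [u, Smash.ofG]
  let ι := Smash.incl w Q χ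
  have hf₀' : ∀ a b, ι a * f₀ b - f₀ (a * b) + f₀ a * ι b = γ.1 (ι a) (ι b) := fun a b =>
    congrArg (fun δ => δ a b) hf₀
  have hconj : ∀ g a, u g * ι a = ι (g • a) * u g := fun g a => by
    rw [← hu]; exact Smash.ofG_mul_incl g a
  obtain ⟨h, hh⟩ := exists_normalization u γ
  let δ : Smash w Q χ →ₗ[𝕜] Smash w Q χ →ₗ[𝕜] Smash w Q χ :=
    γ.1 - hochD1 (AlgHom.id 𝕜 (Smash w Q χ)) h
  have hδ : ∀ x y, δ x y = γ.1 x y - (x * h y - h (x * y) + h x * y) := fun x y => rfl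
  have hδc : ∀ x y z, x * δ y z - δ (x * y) z + δ x (y * z) - δ x y * z = 0 := by
    intro x y z
    have h := γ.2 x y z
    simp only [AlgHom.id_apply] at h
    simp only [hδ, mul_sub, mul_add, sub_mul, add_mul, mul_assoc] at h ⊢
    rw [← h]
    abel
  have hl : ∀ t x, δ (u t) x = 0 := fun t x => sub_eq_zero.mpr (hh t x).1
  have hr : ∀ t x, δ x (u t) = 0 := fun t x => sub_eq_zero.mpr (hh t x).2
  -- Normalisation makes `δ` linear over G on both outer sides and balanced in the middle, so its
  -- restriction to S_q(V) determines it.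
  have hδl : ∀ t x y, δ (u t * x) y = u t * δ x y := fun t x y => by
    have h := hδc (u t) x y
    simp only [hl, zero_mul, add_zero, sub_zero] at h
    exact (sub_eq_zero.mp h).symm
  have hδr : ∀ t x y, δ x (y * u t) = δ x y * u t := fun t x y => by
    have h := hδc x y (u t)
    simp only [hr, mul_zero, zero_sub, neg_zero, zero_add] at h
    exact sub_eq_zero.mp h
  have hδm : ∀ t x y, δ (x * u t) y = δ x (u t * y) := fun t x y => by
    have h := hδc x (u t) y
    simp only [hr, hl, mul_zero, zero_mul, zero_sub, sub_zero] at h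
    rw [← sub_eq_zero, ← neg_eq_zero, ← h]; abel
  have hinv : ∀ g, u g * u g⁻¹ = 1 := fun g => by rw [← map_mul]; simp
  have hinv' : ∀ g, u g⁻¹ * u g = 1 := fun g => by rw [← map_mul]; simp
  let f₁ : QSym w Q χ →ₗ[𝕜] Smash w Q χ := f₀ - h ∘ₗ ι.toLinearMap
  have hf₁ : ∀ a b, ι a * f₁ b - f₁ (a * b) + f₁ a * ι b = δ (ι a) (ι b) := fun a b => by
    change ι a * (f₀ b - h (ι b)) - (f₀ (a * b) - h (ι (a * b))) + (f₀ a - h (ι a)) * ι b = _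
    rw [hδ, ← hf₀', mul_sub, sub_mul, map_mul ι]
    abel
  -- Averaging the conjugates of `f₁` gives a G-equivariant primitive. It is still a primitive of
  -- the same cocycle because δ(ι a, ι b) is itself equivariant.
  let F : QSym w Q χ →ₗ[𝕜] Smash w Q χ := (Fintype.card G : 𝕜)⁻¹ •
    ∑ g, LinearMap.mulLeftRight 𝕜 (u g, u g⁻¹) ∘ₗ f₁ ∘ₗ (QSym.act w Q χ g⁻¹).toLinearMap
  have hF : ∀ a, F a = (Fintype.card G : 𝕜)⁻¹ • ∑ g, u g * f₁ (g⁻¹ • a) * u g⁻¹ := fun a => by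
    simp only [F, LinearMap.smul_apply, LinearMap.sum_apply, LinearMap.comp_apply,
      LinearMap.mulLeftRight_apply]
    rfl
  have hFδ : ∀ a b, ι a * F b - F (a * b) + F a * ι b = δ (ι a) (ι b) := by
    intro a b
    rw [hF, hF, hF, mul_smul_comm, smul_mul_assoc, ← smul_sub, ← smul_add, Finset.mul_sum,
      Finset.sum_mul, ← Finset.sum_sub_distrib, ← Finset.sum_add_distrib,
      inv_smul_eq_iff₀ hN, Nat.cast_smul_eq_nsmul, ← Finset.card_univ, ← Finset.sum_const]
    refine Finset.sum_congr rfl fun g _ => ?_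
    have ha : ∀ a, ι a * u g = u g * ι (g⁻¹ • a) := fun a => by
      rw [hconj, smul_inv_smul]
    have hb : ∀ a, u g⁻¹ * ι a = ι (g⁻¹ • a) * u g⁻¹ := hconj g⁻¹
    calc _ = u g * (ι (g⁻¹ • a) * f₁ (g⁻¹ • b) - f₁ ((g⁻¹ • a) * (g⁻¹ • b))
          + f₁ (g⁻¹ • a) * ι (g⁻¹ • b)) * u g⁻¹ := by
            rw [smul_mul']
            simp only [mul_add, mul_sub, add_mul, sub_mul, mul_assoc, hb]
            simp only [← mul_assoc, ha]
      _ = δ (ι a) (ι b) := by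
        rw [hf₁, ← hδl, ← hδr, ← ha, ← hb, hδm, ← mul_assoc, hinv, one_mul]
  have hFe : ∀ t a, u t * F a = F (t • a) * u t := by
    intro t a
    rw [hF, hF, mul_smul_comm, smul_mul_assoc, Finset.mul_sum, Finset.sum_mul]
    congr 1
    refine Fintype.sum_equiv (Equiv.mulLeft t) _ _ fun g => ?_
    simp [mul_assoc, smul_smul, hinv']
  -- Equivariance of `F` lets all group elements be moved to the right, reducing the identity to the
  -- one on S_q(V).
  have key : ∀ s t a b, (ι a * u s) * (F b * u t) - F (a * (s • b)) * u (s * t)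
      + (F a * u s) * (ι b * u t) = δ (ι a * u s) (ι b * u t) := by
    intro s t a b
    have e₁ : (ι a * u s) * (F b * u t) = ι a * F (s • b) * u s * u t := by
      rw [mul_assoc, ← mul_assoc (u s), hFe]
      simp only [mul_assoc]
    have e₂ : (F a * u s) * (ι b * u t) = F a * ι (s • b) * u s * u t := by
      rw [mul_assoc, ← mul_assoc (u s), hconj]
      simp only [mul_assoc]
    rw [e₁, e₂, hδr, hδm, hconj, hδr, ← hFδ, map_mul u, ← mul_assoc, ← sub_mul, ← sub_mul,
      ← add_mul, ← add_mul]
  have hE : ∀ s a, Smash.extendRight F (SkewMonoidAlgebra.single s a) = F a * u s := fun s a => by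
    rw [Smash.extendRight_single, hu]
  have hsingle : ∀ s a, (SkewMonoidAlgebra.single s a : Smash w Q χ) = ι a * u s := fun s a => by
    rw [Smash.single_eq, hu]
  have hK : hochD1 (AlgHom.id 𝕜 (Smash w Q χ)) (Smash.extendRight F) = δ := by
    refine SkewMonoidAlgebra.lhom_ext fun s a => ?_
    refine SkewMonoidAlgebra.lhom_ext fun t b => ?_
    rw [hochD1_apply, SkewMonoidAlgebra.single_mul_single, hE, hE, hE, hsingle, hsingle]
    exact key s t a b
  refine ⟨h + Smash.extendRight F, ?_⟩
  rw [map_add, hK]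
  exact add_sub_cancel _ _

end Restriction

/-! ### Ordered monomials and skew commutation -/

section Monomials

variable {𝕜 V : Type*} [Field 𝕜] [AddCommGroup V] [Module 𝕜 V] {k : ℕ} {G : Type*} [Group G]
variable {w : Module.Basis (Fin k) 𝕜 V} {Q : Fin k → Fin k → 𝕜ˣ} {χ : Fin k → G →* 𝕜ˣ}

namespace QSym

theorem mono_eq (α : Fin k → ℕ) :
    mono w Q χ α = ((List.finRange k).map fun i => gen w Q χ i ^ α i).prod := by
  rw [← List.ofFn_eq_map]; rfl

theorem mono_zero : mono w Q χ 0 = 1 := by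
  rw [mono_eq]
  exact List.prod_eq_one (by simp)

theorem pow_mul_gen (j i : Fin k) (n : ℕ) : gen w Q χ j ^ n * gen w Q χ i =
    (Q j i : 𝕜) ^ n • (gen w Q χ i * gen w Q χ j ^ n) := by
  induction n with
  | zero => simp
  | succ n ih =>
    rw [pow_succ, mul_assoc, gen_mul_gen, mul_smul_comm, ← mul_assoc, ih, smul_mul_assoc, smul_smul,
      mul_assoc, ← pow_succ']

theorem mono_mul_gen (α : Fin k → ℕ) (i : Fin k) : mono w Q χ α * gen w Q χ i =
    (∏ j, (Q j i : 𝕜) ^ α j) • (gen w Q χ i * mono w Q χ α) := by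
  have key : ∀ l : List (Fin k), (l.map fun j => gen w Q χ j ^ α j).prod * gen w Q χ i =
      (l.map fun j => (Q j i : 𝕜) ^ α j).prod •
        (gen w Q χ i * (l.map fun j => gen w Q χ j ^ α j).prod) := by
    intro l
    induction l with
    | nil => simp
    | cons a l ih =>
      simp only [List.map_cons, List.prod_cons]
      rw [mul_assoc, ih, mul_smul_comm, ← mul_assoc, pow_mul_gen, smul_mul_assoc, smul_smul,
        mul_assoc, mul_comm]
  rw [mono_eq, key, ← List.ofFn_eq_map (f := fun j => (Q j i : 𝕜) ^ α j), List.prod_ofFn]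

theorem exists_gen_mul_mono (i : Fin k) (α : Fin k → ℕ) :
    ∃ c : 𝕜, gen w Q χ i * mono w Q χ α = c • mono w Q χ (α + Pi.single i 1) := by
  have key : ∀ l : List (Fin k), l.Nodup → i ∈ l → ∃ c : 𝕜,
      gen w Q χ i * (l.map fun j => gen w Q χ j ^ α j).prod =
        c • (l.map fun j => gen w Q χ j ^ (α + Pi.single i 1 : Fin k → ℕ) j).prod := by
    intro l hl hi
    induction l with
    | nil => simp at hi
    | cons a l ih =>
      rw [List.nodup_cons] at hl
      simp only [List.map_cons, List.prod_cons]
      by_cases hai : a = i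
      · subst hai
        refine ⟨1, ?_⟩
        have : l.map (fun j => gen w Q χ j ^ (α + Pi.single a 1 : Fin k → ℕ) j) =
            l.map fun j => gen w Q χ j ^ α j := by
          refine List.map_congr_left fun j hj => ?_
          have : j ≠ a := fun h => hl.1 (h ▸ hj)
          simp [this]
        rw [this, ← mul_assoc, ← pow_succ']
        simp
      · obtain ⟨c, hc⟩ := ih hl.2 ((List.mem_cons.mp hi).resolve_left (Ne.symm hai))
        have h := pow_mul_gen (w := w) (Q := Q) (χ := χ) a i (α a)
        have h' : gen w Q χ i * gen w Q χ a ^ α a =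
            ((Q a i : 𝕜) ^ α a)⁻¹ • (gen w Q χ a ^ α a * gen w Q χ i) := by
          rw [h, inv_smul_smul₀ (pow_ne_zero _ (Q a i).ne_zero)]
        refine ⟨((Q a i : 𝕜) ^ α a)⁻¹ * c, ?_⟩
        rw [← mul_assoc, h', smul_mul_assoc, mul_assoc, hc, mul_smul_comm, smul_smul]
        simp [hai]
  obtain ⟨c, hc⟩ := key _ (List.nodup_finRange k) (List.mem_finRange i)
  exact ⟨c, by rw [mono_eq, hc, mono_eq]⟩

/-- A subalgebra generated by variables is spanned by the monomials in these variables. -/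
theorem mem_span_mono_of_mem_adjoin {S : Set (Fin k)}
    {x : QSym w Q χ} (hx : x ∈ Algebra.adjoin 𝕜 (gen w Q χ '' S)) :
    x ∈ Submodule.span 𝕜 (mono w Q χ '' {α | ∀ i ∉ S, α i = 0}) := by
  -- Stability of the span under left multiplication by `x` passes to products; evaluating at 1
  -- gives the claim.
  have key : ∀ y ∈ Submodule.span 𝕜 (mono w Q χ '' {α | ∀ i ∉ S, α i = 0}),
      x * y ∈ Submodule.span 𝕜 (mono w Q χ '' {α | ∀ i ∉ S, α i = 0}) := by
    induction hx using Algebra.adjoin_induction with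
    | mem x hx =>
      obtain ⟨i, hi, rfl⟩ := hx
      intro y hy
      induction hy using Submodule.span_induction with
      | mem y hy =>
        obtain ⟨α, hα, rfl⟩ := hy
        obtain ⟨c, hc⟩ := exists_gen_mul_mono (w := w) (Q := Q) (χ := χ) i α
        rw [hc]
        refine Submodule.smul_mem _ _ (Submodule.subset_span ⟨_, fun j hj => ?_, rfl⟩)
        have : j ≠ i := fun h => hj (h ▸ hi)
        simp [this, hα j hj]
      | zero => simp
      | add y z _ _ hy hz => rw [mul_add]; exact add_mem hy hz
      | smul r y _ hy => rw [mul_smul_comm]; exact Submodule.smul_mem _ _ hy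
    | algebraMap r => intro y hy; rw [← Algebra.smul_def]; exact Submodule.smul_mem _ _ hy
    | add x y _ _ hx hy => intro z hz; rw [add_mul]; exact add_mem (hx z hz) (hy z hz)
    | mul x y _ _ hx hy => intro z hz; rw [mul_assoc]; exact hx _ (hy z hz)
  simpa using key 1 (Submodule.subset_span ⟨0, fun _ _ => rfl, mono_zero⟩)

variable (Q) in
/-- The scalar which appears when `w i * w ^ α` is put into the normal order. -/
def orderCoeff (i : Fin k) (α : Fin k → ℕ) : 𝕜 := ∏ j ∈ Finset.Iio i, (Q i j : 𝕜) ^ α j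

theorem orderCoeff_ne_zero (i : Fin k) (α : Fin k → ℕ) : orderCoeff Q i α ≠ 0 :=
  Finset.prod_ne_zero_iff.mpr fun j _ => pow_ne_zero _ (Q i j).ne_zero

theorem orderCoeff_add_single (i j : Fin k) (α : Fin k → ℕ) :
    orderCoeff Q i (α + Pi.single j 1) =
      orderCoeff Q i α * if j < i then (Q i j : 𝕜) else 1 := by
  simp only [orderCoeff, Pi.add_apply, pow_add, Finset.prod_mul_distrib]
  congr 1
  by_cases hj : j < i
  · rw [Finset.prod_eq_single j]
    · simp [hj]
    · intro b _ hb; simp [hb]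
    · intro h; exact absurd (Finset.mem_Iio.mpr hj) h
  · rw [if_neg hj]
    refine Finset.prod_eq_one fun b hb => ?_
    have : b ≠ j := fun h => hj (h ▸ Finset.mem_Iio.mp hb)
    simp [this]

variable (Q) in
/-- Multiplication by `w i` on the vector space with basis the normally ordered monomials. -/
def genOp (i : Fin k) : Module.End 𝕜 ((Fin k → ℕ) →₀ 𝕜) :=
  Finsupp.linearCombination 𝕜 fun α => Finsupp.single (α + Pi.single i 1) (orderCoeff Q i α)

theorem genOp_single (i : Fin k) (α : Fin k → ℕ) (r : 𝕜) :
    genOp Q i (Finsupp.single α r) =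
      Finsupp.single (α + Pi.single i 1) (r * orderCoeff Q i α) := by
  simp [genOp]

/-- For i ≠ j the two orders differ only by the crossing of w i with w j, which occurs in just one
of them. -/
theorem genOp_mul_genOp (hQ_diag : ∀ i, Q i i = 1) (hQ_symm : ∀ i j, Q j i = (Q i j)⁻¹)
    (i j : Fin k) : genOp Q i * genOp Q j = (Q i j : 𝕜) • (genOp Q j * genOp Q i) := by
  refine Finsupp.lhom_ext fun α r => ?_
  simp only [Module.End.mul_apply, LinearMap.smul_apply, genOp_single, Finsupp.smul_single,
    orderCoeff_add_single, smul_eq_mul]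
  rw [add_right_comm]
  congr 1
  have hne := (Q i j).ne_zero
  rcases lt_trichotomy i j with h | rfl | h
  · rw [if_neg h.not_gt, if_pos h, hQ_symm i j]
    simp only [Units.val_inv_eq_inv_val]
    field_simp
  · simp [hQ_diag]
  · rw [if_pos h, if_neg h.not_gt]
    ring

/-- The normally ordered monomials act on the vacuum vector through distinct basis vectors. -/
theorem exists_model (hQ_diag : ∀ i, Q i i = 1) (hQ_symm : ∀ i j, Q j i = (Q i j)⁻¹) :
    ∃ ρ : QSym w Q χ →ₐ[𝕜] Module.End 𝕜 ((Fin k → ℕ) →₀ 𝕜),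
      (∀ i, ρ (gen w Q χ i) = genOp Q i) ∧
      ∀ α, ∃ u : 𝕜, u ≠ 0 ∧ ρ (mono w Q χ α) (Finsupp.single 0 1) = Finsupp.single α u := by
  let ρ : QSym w Q χ →ₐ[𝕜] Module.End 𝕜 ((Fin k → ℕ) →₀ 𝕜) :=
    lift (genOp Q) (genOp_mul_genOp hQ_diag hQ_symm)
  have hρ : ∀ i, ρ (gen w Q χ i) = genOp Q i := lift_gen _ _
  refine ⟨ρ, hρ, fun α => ?_⟩
  have hpow : ∀ (i : Fin k) (n : ℕ) (β : Fin k → ℕ) (r : 𝕜), r ≠ 0 → ∃ u : 𝕜, u ≠ 0 ∧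
      (genOp Q i ^ n) (Finsupp.single β r) = Finsupp.single (β + Pi.single i n) u := by
    intro i n β r hr
    induction n with
    | zero => exact ⟨r, hr, by simp⟩
    | succ n ih =>
      obtain ⟨u, hu, h⟩ := ih
      refine ⟨u * orderCoeff Q i (β + Pi.single i n), mul_ne_zero hu (orderCoeff_ne_zero _ _), ?_⟩
      rw [pow_succ', Module.End.mul_apply, h, genOp_single, add_assoc, ← Pi.single_add]
  -- Linear independence needs only that the coefficient is nonzero, so its value is not tracked.
  have key : ∀ l : List (Fin k), ∃ u : 𝕜, u ≠ 0 ∧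
      ρ (l.map fun i => gen w Q χ i ^ α i).prod (Finsupp.single 0 1) =
        Finsupp.single (l.map fun i => (Pi.single i (α i) : Fin k → ℕ)).sum u := by
    intro l
    induction l with
    | nil => exact ⟨1, one_ne_zero, by simp⟩
    | cons a l ih =>
      obtain ⟨u, hu, h⟩ := ih
      obtain ⟨v, hv, h'⟩ := hpow a (α a) _ u hu
      refine ⟨v, hv, ?_⟩
      rw [List.map_cons, List.prod_cons, map_mul, Module.End.mul_apply, h, map_pow, hρ, h',
        List.map_cons, List.sum_cons, add_comm]
  obtain ⟨u, hu, h⟩ := key (List.finRange k)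
  refine ⟨u, hu, ?_⟩
  rw [mono_eq, h, ← List.ofFn_eq_map, List.sum_ofFn, Finset.univ_sum_single]

/-- An element of a subalgebra generated by variables which skew commutes with some variables is a
combination of monomials with the same property. -/
theorem mem_span_mono_of_skewCommute (hQ_diag : ∀ i, Q i i = 1)
    (hQ_symm : ∀ i j, Q j i = (Q i j)⁻¹) {S T : Set (Fin k)} {x : QSym w Q χ}
    (hx : x ∈ Algebra.adjoin 𝕜 (gen w Q χ '' S)) (c : Fin k → 𝕜)
    (hc : ∀ i ∈ T, x * gen w Q χ i = c i • (gen w Q χ i * x)) :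
    x ∈ Submodule.span 𝕜 (mono w Q χ ''
      {α | (∀ i ∉ S, α i = 0) ∧ ∀ i ∈ T, ∏ j, (Q j i : 𝕜) ^ α j = c i}) := by
  obtain ⟨l, hl, rfl⟩ := (Finsupp.mem_span_image_iff_linearCombination 𝕜).mp
    (mem_span_mono_of_mem_adjoin hx)
  obtain ⟨ρ, hρ, hmono⟩ := exists_model (w := w) (χ := χ) hQ_diag hQ_symm
  rw [Finsupp.linearCombination_apply, Finsupp.sum]
  refine Submodule.sum_mem _ fun α hα => Submodule.smul_mem _ _ (Submodule.subset_span
    ⟨α, ⟨(Finsupp.mem_supported _ _).mp hl hα, fun i hi => ?_⟩, rfl⟩)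
  have h := hc i hi
  rw [Finsupp.linearCombination_apply, Finsupp.sum, Finset.sum_mul, Finset.mul_sum,
    Finset.smul_sum, ← sub_eq_zero, ← Finset.sum_sub_distrib] at h
  have h' : ∑ β ∈ l.support, (l β * (∏ j, (Q j i : 𝕜) ^ β j - c i)) •
      (gen w Q χ i * mono w Q χ β) = 0 := by
    rw [← h]
    refine Finset.sum_congr rfl fun β _ => ?_
    rw [smul_mul_assoc, mono_mul_gen, mul_smul_comm, smul_smul, smul_smul, ← sub_smul]
    congr 1
    ring
  -- On the vacuum vector, w i w^β lands on the basis vector of exponent β + e_i, so this coordinate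
  -- sees only β = α.
  have h'' := congrArg (fun x => ρ x (Finsupp.single 0 1) (α + Pi.single i 1)) h'
  simp only [map_sum, map_smul, map_mul, LinearMap.sum_apply, LinearMap.smul_apply,
    Module.End.mul_apply, hρ, Finsupp.finsetSum_apply, Finsupp.smul_apply, map_zero,
    LinearMap.zero_apply, Finsupp.zero_apply] at h''
  rw [Finset.sum_eq_single α] at h''
  · obtain ⟨u, hu, hα'⟩ := hmono α
    rw [hα', genOp_single, Finsupp.single_eq_same, smul_eq_mul, mul_eq_zero, mul_eq_zero] at h''
    rcases h'' with (h0 | h0) | h0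
    · exact absurd h0 (Finsupp.mem_support_iff.mp hα)
    · exact sub_eq_zero.mp h0
    · exact absurd h0 (mul_ne_zero hu (orderCoeff_ne_zero _ _))
  · intro β _ hβ
    obtain ⟨u, hu, hβ'⟩ := hmono β
    rw [hβ', genOp_single, Finsupp.single_eq_of_ne, smul_zero]
    exact fun h => hβ (add_right_cancel h).symm
  · intro h0
    exact absurd hα h0

end QSym

end Monomials

/-! ### The skew derivations and their cup product -/

section SkewExtension

variable {𝕜 V : Type*} [Field 𝕜] [AddCommGroup V] [Module 𝕜 V] {k : ℕ} {G : Type*} [Group G]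
variable {w : Module.Basis (Fin k) 𝕜 V} {Q : Fin k → Fin k → 𝕜ˣ} {χ : Fin k → G →* 𝕜ˣ}

namespace Smash

variable (w Q χ) in
/-- The diagonal algebra endomorphism `w i ↦ lam i * w i`, `g ↦ ξ g * g` of `S_q(V) # G`. -/
theorem exists_sigma (lam : Fin k → 𝕜ˣ) (ξ : G →* 𝕜ˣ) :
    ∃ σ : Smash w Q χ →ₐ[𝕜] Smash w Q χ,
      (∀ i, σ (incl w Q χ (QSym.gen w Q χ i)) =
        (lam i : 𝕜) • incl w Q χ (QSym.gen w Q χ i)) ∧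
      ∀ g, σ (ofG w Q χ g) = (ξ g : 𝕜) • ofG w Q χ g := by
  let u : G →* Smash w Q χ :=
    { toFun g := (ξ g : 𝕜) • ofG w Q χ g
      map_one' := by simp [ofG_one]
      map_mul' g h := by simp [ofG_mul, smul_smul, mul_comm] }
  refine exists_lift (fun i => (lam i : 𝕜) • incl w Q χ (QSym.gen w Q χ i)) u
    (fun i j => ?_) (fun g i => ?_)
  · rw [smul_mul_smul_comm, smul_mul_smul_comm, ← map_mul, QSym.gen_mul_gen, map_smul, map_mul,
      smul_smul, smul_smul]
    congr 1
    ring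
  · change ((ξ g : 𝕜) • ofG w Q χ g) * _ = _ • (_ * ((ξ g : 𝕜) • ofG w Q χ g))
    rw [smul_mul_smul_comm, smul_mul_smul_comm, ofG_mul_incl, QSym.smul_gen, map_smul,
      smul_mul_assoc, smul_smul, smul_smul]
    congr 1
    ring

theorem incl_mul_single (a b : QSym w Q χ) (g : G) :
    incl w Q χ a * SkewMonoidAlgebra.single g b = SkewMonoidAlgebra.single g (a * b) := by
  simp [SkewMonoidAlgebra.single_mul_single]

theorem single_mul_incl_gen (b : QSym w Q χ) (g : G) (i : Fin k) :
    SkewMonoidAlgebra.single g b * incl w Q χ (QSym.gen w Q χ i) =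
      (χ i g : 𝕜) • SkewMonoidAlgebra.single g (b * QSym.gen w Q χ i) := by
  simp [SkewMonoidAlgebra.single_mul_single, QSym.smul_gen, SkewMonoidAlgebra.smul_single]

theorem ofG_mul_single (g h : G) (b : QSym w Q χ) :
    ofG w Q χ h * SkewMonoidAlgebra.single g b = SkewMonoidAlgebra.single (h * g) (h • b) := by
  simp [ofG, SkewMonoidAlgebra.single_mul_single]

theorem single_mul_ofG (g h : G) (b : QSym w Q χ) :
    SkewMonoidAlgebra.single g b * ofG w Q χ h = SkewMonoidAlgebra.single (g * h) b := by
  simp [ofG, SkewMonoidAlgebra.single_mul_single]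

/-- Existence of a skew derivation which vanishes on `G` and on all but one of the `w i`, when the
twists act diagonally. -/
theorem exists_skewDerivation_single (hQ_diag : ∀ i, Q i i = 1)
    (hQ_symm : ∀ i j, Q j i = (Q i j)⁻¹)
    (φ ψ : Smash w Q χ →ₐ[𝕜] Smash w Q χ) (a b : Fin k → 𝕜ˣ) (α β : G →* 𝕜ˣ)
    (hφ : ∀ i, φ (incl w Q χ (QSym.gen w Q χ i)) = (a i : 𝕜) • incl w Q χ (QSym.gen w Q χ i))
    (hψ : ∀ i, ψ (incl w Q χ (QSym.gen w Q χ i)) = (b i : 𝕜) • incl w Q χ (QSym.gen w Q χ i))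
    (hφG : ∀ g, φ (ofG w Q χ g) = (α g : 𝕜) • ofG w Q χ g)
    (hψG : ∀ g, ψ (ofG w Q χ g) = (β g : 𝕜) • ofG w Q χ g)
    (i₀ : Fin k) (P : QSym w Q χ) (g₀ : G) (hg₀ : g₀ ∈ Subgroup.center G)
    (hP : ∀ j, j ≠ i₀ → P * QSym.gen w Q χ j =
      ((Q i₀ j : 𝕜) * (a j : 𝕜) * (b j : 𝕜)⁻¹ * (χ j g₀⁻¹ : 𝕜)) • (QSym.gen w Q χ j * P))
    (hPG : ∀ g : G, g • P = ((χ i₀ g : 𝕜) * (β g : 𝕜) * (α g : 𝕜)⁻¹) • P) :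
    ∃ D : Smash w Q χ →ₗ[𝕜] Smash w Q χ,
      D (incl w Q χ (QSym.gen w Q χ i₀)) = SkewMonoidAlgebra.single g₀ P ∧
      (∀ i, i ≠ i₀ → D (incl w Q χ (QSym.gen w Q χ i)) = 0) ∧
      (∀ g, D (ofG w Q χ g) = 0) ∧ ∀ x y, D (x * y) = φ x * D y + D x * ψ y := by
  -- Moving w j past g₀ gives χ_j(g₀), which together with b_j cancels the inverse factors in `hP`.
  have hsw : ∀ j, j ≠ i₀ →
      SkewMonoidAlgebra.single g₀ P * ψ (incl w Q χ (QSym.gen w Q χ j)) =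
      (Q i₀ j : 𝕜) • (φ (incl w Q χ (QSym.gen w Q χ j)) * SkewMonoidAlgebra.single g₀ P) := by
    intro j hj
    have hb := (b j).ne_zero
    have hχ := (χ j g₀).ne_zero
    rw [hφ, hψ, mul_smul_comm, smul_mul_assoc, single_mul_incl_gen, incl_mul_single, hP j hj,
      ← SkewMonoidAlgebra.smul_single, smul_smul, smul_smul, smul_smul]
    congr 1
    simp only [map_inv, Units.val_inv_eq_inv_val]
    field_simp
  let y : Fin k → Smash w Q χ := fun i => if i = i₀ then SkewMonoidAlgebra.single g₀ P else 0
  have hy₀ : y i₀ = SkewMonoidAlgebra.single g₀ P := if_pos rfl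
  have hy : ∀ i, i ≠ i₀ → y i = 0 := fun i hi => if_neg hi
  obtain ⟨D, h₁, h₂, h₃⟩ := exists_skewDerivation φ ψ y
    (by
      intro i j
      by_cases hi : i = i₀
      · by_cases hj : j = i₀
        · subst hi; subst hj; simp [hQ_diag]
        · rw [hi, hy₀, hy j hj, mul_zero, zero_add, zero_mul, add_zero, hsw j hj]
      · by_cases hj : j = i₀
        · rw [hj, hy₀, hy i hi, zero_mul, add_zero, mul_zero, zero_add, hsw i hi, smul_smul,
            hQ_symm i₀ i]
          simp
        · simp [hy i hi, hy j hj])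
    (by
      intro g i
      by_cases hi : i = i₀
      · have hα := (α g).ne_zero
        rw [hi, hy₀, hφG, hψG, smul_mul_assoc, mul_smul_comm, ofG_mul_single, single_mul_ofG,
          hPG, ← SkewMonoidAlgebra.smul_single, smul_smul, smul_smul,
          Subgroup.mem_center_iff.mp hg₀ g]
        congr 1
        field_simp
      · simp [hy i hi])
  exact ⟨D, by rw [h₁, hy₀], fun i hi => by rw [h₁, hy i hi], h₂, h₃⟩

end Smash

/-- The skew derivations `D₁`, `D₂` of `S_q(V) # G` exist. -/
theorem exists_isSkewExtension (hQ_diag : ∀ i, Q i i = 1) (hQ_symm : ∀ i j, Q j i = (Q i j)⁻¹)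
    (i₁ i₂ : Fin k) (lam : Fin k → 𝕜ˣ) (ξ : G →* 𝕜ˣ) (g₁ g₂ : G) (P₁ P₂ : QSym w Q χ)
    (hqP₁ : ∀ j, j ≠ i₁ → P₁ * QSym.gen w Q χ j =
      ((Q i₁ j : 𝕜) * (lam j : 𝕜)⁻¹ * (χ j g₁⁻¹ : 𝕜)) • (QSym.gen w Q χ j * P₁))
    (hqP₂ : ∀ j, j ≠ i₂ → P₂ * QSym.gen w Q χ j =
      ((Q i₂ j : 𝕜) * (lam j : 𝕜) * (χ j g₂⁻¹ : 𝕜)) • (QSym.gen w Q χ j * P₂))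
    (hg₁ : g₁ ∈ Subgroup.center G) (hg₂ : g₂ ∈ Subgroup.center G)
    (hP₁ : ∀ g : G, g • P₁ = ((χ i₁ g : 𝕜) * (ξ g : 𝕜)) • P₁)
    (hP₂ : ∀ g : G, g • P₂ = ((χ i₂ g : 𝕜) * (ξ g⁻¹ : 𝕜)) • P₂) :
    ∃ σ D₁ D₂ : Smash w Q χ →ₗ[𝕜] Smash w Q χ,
      IsSkewExtension w Q χ i₁ i₂ lam ξ P₁ P₂ g₁ g₂ σ D₁ D₂ := by
  obtain ⟨σ, hσ, hσG⟩ := Smash.exists_sigma w Q χ lam ξ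
  -- The twist σ sits on the right for `D₁` and on the left for `D₂`; hence λ_j⁻¹ and ξ(g) for P₁,
  -- but λ_j and ξ(g⁻¹) for P₂.
  obtain ⟨D₁, h₁, h₁', h₁G, h₁m⟩ := Smash.exists_skewDerivation_single hQ_diag hQ_symm
    (AlgHom.id 𝕜 _) σ 1 lam 1 ξ (by simp) hσ (by simp) hσG i₁ P₁ g₁ hg₁
    (fun j hj => by simpa using hqP₁ j hj) (fun g => by simpa using hP₁ g)
  obtain ⟨D₂, h₂, h₂', h₂G, h₂m⟩ := Smash.exists_skewDerivation_single hQ_diag hQ_symm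
    σ (AlgHom.id 𝕜 _) lam 1 ξ 1 hσ (by simp) hσG (by simp) i₂ P₂ g₂ hg₂
    (fun j hj => by simpa using hqP₂ j hj) (fun g => by simpa using hP₂ g)
  exact ⟨σ.toLinearMap, D₁, D₂, hσ, hσG, map_mul σ, h₁, h₁', h₁G,
    fun x y => by rw [h₁m, add_comm]; rfl, h₂, h₂', h₂G, fun x y => by rw [h₂m, add_comm]; rfl⟩

namespace IsSkewExtension

variable {i₁ i₂ : Fin k} {lam : Fin k → 𝕜ˣ} {ξ : G →* 𝕜ˣ} {P₁ P₂ : QSym w Q χ} {g₁ g₂ : G}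
  {σ D₁ D₂ : Smash w Q χ →ₗ[𝕜] Smash w Q χ}

/-- The cup product of `D₁` and `D₂`. -/
def cup (h : IsSkewExtension w Q χ i₁ i₂ lam ξ P₁ P₂ g₁ g₂ σ D₁ D₂) :
    hochCocycles2 (AlgHom.id 𝕜 (Smash w Q χ)) :=
  ⟨(LinearMap.mul 𝕜 (Smash w Q χ)).compl₁₂ D₁ D₂, fun a b c => by
    -- The two terms D₁(a) σ(b) D₂(c) carry opposite signs; this is where the twists match.
    simp only [AlgHom.id_apply, LinearMap.compl₁₂_apply, LinearMap.mul_apply', h.D₁_mul, h.D₂_mul,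
      mul_add, add_mul, mul_assoc]
    abel⟩

/-- As `i₁` is the least index and `D₁` kills every other generator, the swapped terms γ(w j, w i)
with i < j all vanish. -/
theorem represents (h : IsSkewExtension w Q χ i₁ i₂ lam ξ P₁ P₂ g₁ g₂ σ D₁ D₂)
    (hi₁ : i₁.val = 0) (hi₁₂ : i₁ < i₂) :
    Represents w Q χ ((SkewMonoidAlgebra.single g₁ P₁ * SkewMonoidAlgebra.single g₂ P₂ :
      Smash w Q χ) ⊗ₜ[𝕜] (dualGen w Q i₁ * dualGen w Q i₂))
      (HH2.res (Smash.incl w Q χ) (Submodule.Quotient.mk h.cup)) := by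
  refine ⟨hochRes2 (Smash.incl w Q χ) h.cup, rfl, ?_⟩
  have hval : ∀ i j, (hochRes2 (Smash.incl w Q χ) h.cup).1 (QSym.gen w Q χ i) (QSym.gen w Q χ j) =
      D₁ (Smash.incl w Q χ (QSym.gen w Q χ i)) * D₂ (Smash.incl w Q χ (QSym.gen w Q χ j)) :=
    fun _ _ => rfl
  have hval0 : ∀ i j, i < j → (hochRes2 (Smash.incl w Q χ) h.cup).1 (QSym.gen w Q χ j)
      (QSym.gen w Q χ i) = 0 := fun i j hij => by
    have hj : j ≠ i₁ := by
      rintro rfl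
      have := Fin.lt_def.mp hij
      omega
    rw [hval, h.D₁_gen_ne j hj, zero_mul]
  rw [toKoszul, Finset.sum_eq_single i₁, Finset.sum_eq_single i₂]
  · rw [hval0 i₁ i₂ hi₁₂, hval, h.D₁_gen, h.D₂_gen, smul_zero, sub_zero]
  · intro j hj hj'
    rw [hval0 i₁ j (Finset.mem_Ioi.mp hj), hval, h.D₂_gen_ne j hj', mul_zero, smul_zero, sub_zero,
      TensorProduct.zero_tmul]
  · intro hi
    exact absurd (Finset.mem_Ioi.mpr hi₁₂) hi
  · intro i _ hi
    refine Finset.sum_eq_zero fun j hj => ?_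
    rw [hval0 i j (Finset.mem_Ioi.mp hj), hval, h.D₁_gen_ne i hi, zero_mul, smul_zero, sub_zero,
      TensorProduct.zero_tmul]
  · simp

end IsSkewExtension

end SkewExtension

/-! ### Naidu's condition -/

section Naidu

variable {𝕜 V : Type*} [Field 𝕜] [AddCommGroup V] [Module 𝕜 V] {k : ℕ} {G : Type*} [Group G]
variable {w : Module.Basis (Fin k) 𝕜 V} {Q : Fin k → Fin k → 𝕜ˣ} {χ : Fin k → G →* 𝕜ˣ}

theorem dualMono_single_add_single {i₁ i₂ : Fin k} (hi₁ : i₁.val = 0) (hi₂ : i₂.val = 1) :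
    dualMono w Q (Pi.single i₁ 1 + Pi.single i₂ 1) = dualGen w Q i₁ * dualGen w Q i₂ := by
  obtain ⟨n, rfl⟩ : ∃ n, k = n + 2 := ⟨k - 2, by omega⟩
  obtain rfl : i₁ = 0 := Fin.ext hi₁
  obtain rfl : i₂ = 1 := Fin.ext hi₂
  have h : ∀ i : Fin n, i.succ.succ ≠ 1 := fun i h => by simp [Fin.ext_iff] at h
  rw [dualMono, QAlg.mono, List.ofFn_succ, List.ofFn_succ, List.prod_cons, List.prod_cons,
    List.prod_eq_one (l := List.ofFn _)]
  · simp [dualGen]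
  · simp [h]

theorem prod_zpow_sub_one_sub_one (x : Fin k → 𝕜ˣ) (α : Fin k → ℕ) (i₁ i₂ : Fin k) :
    ∏ j, x j ^ ((α j : ℤ) - ((Pi.single i₁ 1 + Pi.single i₂ 1 : Fin k → ℕ) j : ℤ)) =
      (∏ j, x j ^ α j) * (x i₁)⁻¹ * (x i₂)⁻¹ := by
  simp only [zpow_sub, zpow_natCast, Finset.prod_mul_distrib, Finset.prod_inv_distrib,
    Pi.add_apply, pow_add, mul_inv, mul_assoc]
  congr 3
  · rw [Finset.prod_eq_single i₁] <;> simp +contextual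
  · rw [Finset.prod_eq_single i₂] <;> simp +contextual

/-- A Koszul cochain `x # g ⊗ w₁* ∧ w₂*` with `x` a skew commuting polynomial in the remaining
variables satisfies Naidu's condition. -/
theorem single_tmul_mem_naiduHH2 (hQ_diag : ∀ i, Q i i = 1)
    (hQ_symm : ∀ i j, Q j i = (Q i j)⁻¹) {i₁ i₂ : Fin k} (hi₁ : i₁.val = 0) (hi₂ : i₂.val = 1)
    {x : QSym w Q χ} {g : G}
    (hx : x ∈ Algebra.adjoin 𝕜 (QSym.gen w Q χ '' {i | i ≠ i₁ ∧ i ≠ i₂}))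
    (hc : ∀ i, i ≠ i₁ → i ≠ i₂ → x * QSym.gen w Q χ i =
      ((Q i₁ i : 𝕜) * (Q i₂ i : 𝕜) * (χ i g : 𝕜)⁻¹) • (QSym.gen w Q χ i * x)) :
    (SkewMonoidAlgebra.single g x : Smash w Q χ) ⊗ₜ[𝕜] (dualGen w Q i₁ * dualGen w Q i₂) ∈
      naiduHH2 w Q χ := by
  have hne : i₁ ≠ i₂ := fun h => by rw [h, hi₂] at hi₁; exact one_ne_zero hi₁
  have hx' := QSym.mem_span_mono_of_skewCommute hQ_diag hQ_symm hx
    (T := {i | i ≠ i₁ ∧ i ≠ i₂}) _ (fun i hi => hc i hi.1 hi.2)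
  let L : QSym w Q χ →ₗ[𝕜] Cochain w Q χ :=
    (TensorProduct.mk 𝕜 (Smash w Q χ) (DualExt w Q)).flip (dualGen w Q i₁ * dualGen w Q i₂) ∘ₗ
      SkewMonoidAlgebra.lsingle 𝕜 g
  refine Submodule.span_le (p := (naiduHH2 w Q χ).comap L) |>.mpr ?_ hx'
  rintro _ ⟨α, ⟨hα, hα'⟩, rfl⟩
  have hα₁ : α i₁ = 0 := hα i₁ (by simp)
  have hα₂ : α i₂ = 0 := hα i₂ (by simp)
  -- Since α vanishes at `i₁` and `i₂`, the entries of α − β there are −1; only the other indices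
  -- need the character identity.
  refine Submodule.subset_span ⟨g, Pi.single i₁ 1 + Pi.single i₂ 1, α, ?_, ?_, ⟨?_, ?_⟩, ?_⟩
  · intro i
    by_cases h₁ : i = i₁
    · subst h₁; simp [hne]
    · by_cases h₂ : i = i₂
      · subst h₂; simp [hne.symm]
      · simp [h₁, h₂]
  · simp [Finset.sum_add_distrib]
  · intro i
    by_cases h₁ : i = i₁
    · subst h₁; simp [hne, hα₁]
    · by_cases h₂ : i = i₂
      · subst h₂; simp [hne.symm, hα₂]
      · simp only [Pi.add_apply, Pi.single_eq_of_ne h₁, Pi.single_eq_of_ne h₂]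
        omega
  · intro i
    by_cases h₁ : i = i₁
    · subst h₁; right; simp [hne, hα₁]
    · by_cases h₂ : i = i₂
      · subst h₂; right; simp [hne.symm, hα₂]
      · left
        have h := hα' i ⟨h₁, h₂⟩
        have h' : ∏ j, Q j i ^ α j = Q i₁ i * Q i₂ i * (χ i g)⁻¹ := by
          ext; push_cast; exact h
        -- Commuting w^α past w i produces q_ji, whereas `naiduC` uses q_ij.
        have h'' : ∏ j, Q i j ^ α j = (∏ j, Q j i ^ α j)⁻¹ := by
          rw [← Finset.prod_inv_distrib]
          refine Finset.prod_congr rfl fun j _ => ?_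
          rw [hQ_symm j i, inv_pow]
        rw [prod_zpow_sub_one_sub_one, h'', h', hQ_symm i₁ i, hQ_symm i₂ i]
        rw [inv_inv, inv_inv, mul_assoc, mul_inv_rev, inv_inv, mul_assoc, inv_mul_cancel, mul_one]
  · rw [dualMono_single_add_single hi₁ hi₂]
    rfl

end Naidu

end

/-! ### The class of κ -/

theorem mainTheorem7 {𝕜 V : Type*} [Field 𝕜] [CharZero 𝕜] [AddCommGroup V] [Module 𝕜 V]
    {k : ℕ} {G : Type*} [Group G] [Finite G]
    (w : Module.Basis (Fin k) 𝕜 V) (Q : Fin k → Fin k → 𝕜ˣ) (χ : Fin k → G →* 𝕜ˣ)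
    (hQ_diag : ∀ i, Q i i = 1) (hQ_symm : ∀ i j, Q j i = (Q i j)⁻¹)
    -- `i₁` and `i₂` are the indices of `w_1` and `w_2`
    (hk : 3 ≤ k) (i₁ i₂ : Fin k) (hi₁ : i₁.val = 0) (hi₂ : i₂.val = 1)
    (q : 𝕜ˣ) (lam : Fin k → 𝕜ˣ) (ξ : G →* 𝕜ˣ) (g₁ g₂ : G)
    (P₁ P₂ : QSym w Q χ) (qP₁ qP₂ : Fin k → 𝕜)
    (hqP₁ : ∀ j, j ≠ i₁ → P₁ * QSym.gen w Q χ j = qP₁ j • (QSym.gen w Q χ j * P₁))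
    (hqP₂ : ∀ j, j ≠ i₂ → P₂ * QSym.gen w Q χ j = qP₂ j • (QSym.gen w Q χ j * P₂))
    (h_qP₁_eq : ∀ i, i ≠ i₁ → qP₁ i = (Q i₁ i : 𝕜) * (lam i : 𝕜)⁻¹ * (χ i g₁⁻¹ : 𝕜))
    (h_qP₂_eq : ∀ i, i ≠ i₂ → qP₂ i = (Q i₂ i : 𝕜) * (lam i : 𝕜) * (χ i g₂⁻¹ : 𝕜))
    (hg₁ : g₁ ∈ Subgroup.center G) (hg₂ : g₂ ∈ Subgroup.center G)
    (hP₁ : ∀ g : G, g • P₁ = ((χ i₁ g : 𝕜) * (ξ g : 𝕜)) • P₁)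
    (hP₂ : ∀ g : G, g • P₂ = ((χ i₂ g : 𝕜) * (ξ g⁻¹ : 𝕜)) • P₂)
    -- conditions on the extensions of `σ, D₁, D₂` to the smash product
    (h_ker : ∀ σ D₁ D₂ : Smash w Q χ →ₗ[𝕜] Smash w Q χ,
      IsSkewExtension w Q χ i₁ i₂ lam ξ P₁ P₂ g₁ g₂ σ D₁ D₂ →
        D₂ (Smash.incl w Q χ P₁) = 0 ∧ D₁ (Smash.incl w Q χ P₂) = 0)
    (h_sigma : ∀ σ D₁ D₂ : Smash w Q χ →ₗ[𝕜] Smash w Q χ,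
      IsSkewExtension w Q χ i₁ i₂ lam ξ P₁ P₂ g₁ g₂ σ D₁ D₂ →
        σ (Smash.incl w Q χ P₁) =
            ((q : 𝕜)⁻¹ * (lam i₁ : 𝕜) * (ξ g₁⁻¹ : 𝕜)) • Smash.incl w Q χ P₁ ∧
          σ (Smash.incl w Q χ P₂) =
            ((q : 𝕜)⁻¹ * (lam i₂ : 𝕜) * (ξ g₂⁻¹ : 𝕜)) • Smash.incl w Q χ P₂)
    (h_nil : ∀ σ D₁ D₂ : Smash w Q χ →ₗ[𝕜] Smash w Q χ,
      IsSkewExtension w Q χ i₁ i₂ lam ξ P₁ P₂ g₁ g₂ σ D₁ D₂ →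
        ∀ n : ℕ, 2 ≤ n → IsPrimitiveRoot (q : 𝕜) n → D₁ ^ n = 0 ∧ D₂ ^ n = 0)
    (hP₁_mem : P₁ ∈ Algebra.adjoin 𝕜 (QSym.gen w Q χ '' {i | i ≠ i₁ ∧ i ≠ i₂}))
    (hP₂_mem : P₂ ∈ Algebra.adjoin 𝕜 (QSym.gen w Q χ '' {i | i ≠ i₁ ∧ i ≠ i₂}))
    (κ : Cochain w Q χ)
    (hκ : κ = (SkewMonoidAlgebra.single g₁ P₁ * SkewMonoidAlgebra.single g₂ P₂ : Smash w Q χ) ⊗ₜ[𝕜]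
      (dualGen w Q i₁ * dualGen w Q i₂)) :
    κ ∈ naiduHH2 w Q χ ∧
    (∃! c : HH2 (Smash.incl w Q χ), Represents w Q χ κ c) ∧
    (∀ g : G, cochainAct w Q χ g κ = κ) ∧
    ∃! c : HH2 (AlgHom.id 𝕜 (Smash w Q χ)),
      Represents w Q χ κ (HH2.res (Smash.incl w Q χ) c) := by
  have hi₁₂ : i₁ < i₂ := by rw [Fin.lt_def]; omega
  have hqP₁' : ∀ j, j ≠ i₁ → P₁ * QSym.gen w Q χ j =
      ((Q i₁ j : 𝕜) * (lam j : 𝕜)⁻¹ * (χ j g₁⁻¹ : 𝕜)) • (QSym.gen w Q χ j * P₁) := fun j hj => by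
    rw [← h_qP₁_eq j hj, hqP₁ j hj]
  have hqP₂' : ∀ j, j ≠ i₂ → P₂ * QSym.gen w Q χ j =
      ((Q i₂ j : 𝕜) * (lam j : 𝕜) * (χ j g₂⁻¹ : 𝕜)) • (QSym.gen w Q χ j * P₂) := fun j hj => by
    rw [← h_qP₂_eq j hj, hqP₂ j hj]
  obtain ⟨σ, D₁, D₂, hD⟩ := exists_isSkewExtension hQ_diag hQ_symm i₁ i₂ lam ξ g₁ g₂ P₁ P₂
    hqP₁' hqP₂' hg₁ hg₂ hP₁ hP₂
  have hrep := hD.represents hi₁ hi₁₂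
  rw [← hκ] at hrep
  have hprod : (SkewMonoidAlgebra.single g₁ P₁ * SkewMonoidAlgebra.single g₂ P₂ : Smash w Q χ) =
      ((χ i₂ g₁ : 𝕜) * (ξ g₁⁻¹ : 𝕜)) • SkewMonoidAlgebra.single (g₁ * g₂) (P₁ * P₂) := by
    rw [SkewMonoidAlgebra.single_mul_single, hP₂, mul_smul_comm, SkewMonoidAlgebra.smul_single]
  refine ⟨?_, ⟨_, hrep, fun c hc => hc.unique hQ_diag hQ_symm hrep⟩, fun g => ?_,
    ⟨_, hrep, fun c hc => HH2.res_incl_injective (hc.unique hQ_diag hQ_symm hrep)⟩⟩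
  · rw [hκ, hprod, ← TensorProduct.smul_tmul']
    refine Submodule.smul_mem _ _ (single_tmul_mem_naiduHH2 hQ_diag hQ_symm hi₁ hi₂
      (mul_mem hP₁_mem hP₂_mem) fun i h₁ h₂ => ?_)
    -- In the commutation scalar of P₁P₂ the factors λ_i⁻¹ and λ_i cancel, leaving q_1i q_2i
    -- χ_i(g₁g₂)⁻¹.
    have hl := (lam i).ne_zero
    rw [mul_assoc, hqP₂' i h₂, mul_smul_comm, ← mul_assoc, hqP₁' i h₁, smul_mul_assoc, smul_smul,
      mul_assoc (QSym.gen w Q χ i)]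
    congr 1
    simp only [map_inv, map_mul, Units.val_inv_eq_inv_val, Units.val_mul]
    field_simp
  · have hχ₁ := (χ i₁ g).ne_zero
    have hχ₂ := (χ i₂ g).ne_zero
    have hξ := (ξ g).ne_zero
    -- Centrality fixes the group component, so invariance reduces to the cancellation of scalars.
    have hc : g * (g₁ * g₂) * g⁻¹ = g₁ * g₂ := by
      rw [Subgroup.mem_center_iff.mp (mul_mem hg₁ hg₂) g, mul_inv_cancel_right]
    have hd : ∀ i, dualAct w Q χ g (dualGen w Q i) = (χ i g : 𝕜)⁻¹ • dualGen w Q i := fun i => by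
      rw [dualAct, dualGen, QAlg.diag_gen, Units.val_inv_eq_inv_val]
    rw [hκ, hprod, cochainAct, TensorProduct.map_tmul, map_smul, Smash.conj_single, hc, smul_mul',
      hP₁, hP₂, AlgHom.toLinearMap_apply, map_mul, hd, hd, smul_mul_smul_comm, smul_mul_smul_comm,
      ← SkewMonoidAlgebra.smul_single, smul_comm, TensorProduct.smul_tmul_smul]
    convert one_smul 𝕜 _ using 2
    simp only [map_inv, Units.val_inv_eq_inv_val]
    field_simp
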